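/- Consider the closed-loop system $\mathbf x_{t+1}=\mathbf A\mathbf x_t+\mathbf B\mathbf u_t+\mathbf w_t$ with $\mathbf x_t\in\mathbb R^n$, $\mathbf u_t\in\mathbb R^m$, where $(\mathbf w_t)$ is i.i.d. zero-mean Gaussian with covariance $\mathbf R$. A controller sends packets to the actuator one after another. A packet of length $l\in\mathbb N=\{1,2,\dots\}$ whose transmission starts at slot $t$ carries the control signal $\mathbf K\mathbf A^{l-1}\mathbf x_t$ and arrives in slot $t+l-1$; it is erroneous with probability $g(l)$, where $g$ is non-increasing, and errors are independent in different slots. The next packet starts at slot $t+l$. If the packet is received without error, then $\mathbf u_{t+l-1}=\mathbf K\mathbf A^{l-1}\mathbf x_t$; in all other slots the input is $\mathbf 0$. The gain satisfies $\mathbf A+\mathbf B\mathbf K=\mathbf 0$. The age of information $d_t\in\mathbb N$ at the actuator satisfies $d_{t+1}=l$ if a packet of length $l$ is successfully received in slot $t$, and $d_{t+1}=d_t+1$ otherwise. A stationary deterministic variable-length policy is a map $\pi:\mathbb N\to\mathbb N$; a packet started at slot $t$ has length $\pi(d_t)$. The first packet starts in the initial slot; the initial age is an arbitrary positive integer; the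 initial state has finite second moment; and the initial state, the disturbances and the packet errors are mutually independent. Let $\mathbf Q$ and $\mathbf R$ be symmetric positive semidefinite, let $(\mathbf A,\sqrt{\mathbf R})$ be controllable and $(\mathbf A,\sqrt{\mathbf Q})$ observable (that is, $[\sqrt{\mathbf R},\mathbf A\sqrt{\mathbf R},\dots,\mathbf A^n\sqrt{\mathbf R}]$ and $[\sqrt{\mathbf Q}^{\top},\mathbf A^{\top}\sqrt{\mathbf Q}^{\top},\dots,(\mathbf A^n)^{\top}\sqrt{\mathbf Q}^{\top}]$ have full rank), and let $\rho(\mathbf A)$ be the spectral radius of $\mathbf A$. For a policy let $J_T=\frac1T\sum_{t}\mathbb E[\mathbf x_t^{\top}\mathbf Q\mathbf x_t]$, the sum being over the first $T$ slots. Then there is a stationary deterministic variable-length policy that stabilizes the system, i.e. makes the average cost bounded, if and only if $$\inf_{l\in\mathbb N} g(l)\,\rho(\mathbf A)^{2l}<1.$$ This holds both when "the average cost is bounded" means that $J=\lim_{T\to\infty}J_T$ exists and is finite, and when it only means $\limsup_{T\to\infty}J_T<\infty$. -/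

import Mathlib

open MeasureTheory ProbabilityTheory Filter Topology
open scoped ENNReal NNReal Matrix MatrixOrder

namespace WNCS

noncomputable section

/-- The block matrix `[S, A S, ..., A ^ n S]` has full row rank.  With `S = √R` this says that
`(A, √R)` is controllable. -/
def Controllable {n : ℕ} (A S : Matrix (Fin n) (Fin n) ℝ) : Prop :=
  (Matrix.of fun (i : Fin n) (p : Fin (n + 1) × Fin n) => (A ^ (p.1 : ℕ) * S) i p.2).rank = n

/-- The pair `(A, S)` is observable: `[Sᵀ, Aᵀ Sᵀ, ..., (Aᵀ) ^ n Sᵀ]` has full row rank. -/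
def Observable {n : ℕ} (A S : Matrix (Fin n) (Fin n) ℝ) : Prop :=
  Controllable Aᵀ Sᵀ

/-- The spectral radius of a real square matrix: the largest modulus of its complex eigenvalues. -/
def rho {n : ℕ} (A : Matrix (Fin n) (Fin n) ℝ) : ℝ :=
  (spectralRadius ℂ (A.map Complex.ofReal)).toReal

/-- The data of the control loop: state dimension `n`, input dimension `m`, system matrix `A`,
input matrix `B`, controller gain `K`. -/
structure Loop (n m : ℕ) where
  A : Matrix (Fin n) (Fin n) ℝ
  B : Matrix (Fin n) (Fin m) ℝ
  K : Matrix (Fin m) (Fin n) ℝ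

/-- A stationary deterministic variable-length policy: the length (in slots, at least one) of the
packet whose transmission starts when the age of information is `d`. -/
abbrev Policy := ℕ+ → ℕ+

/-- The configuration at the beginning of slot `t`. -/
structure Config (n m : ℕ) where
  /-- the plant state `x_t` -/
  x : Fin n → ℝ
  /-- the age of information `d_t` at the actuator -/
  aoi : ℕ+
  /-- the length `l` of the packet which is being transmitted during slot `t` -/
  len : ℕ+
  /-- the number of slots this packet has already used before slot `t`; the packet was generated
  at slot `t - used` -/
  used : ℕ
  /-- the control signal carried by this packet -/
  payload : Fin m → ℝ

variable {n m : ℕ}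

/-- The controller starts the transmission of a new packet at a slot with plant state `x` and age
of information `d`.  The packet has length `l = π d` and carries the predictive control signal
`K A ^ (l - 1) x`. -/
def newPacket (S : Loop n m) (π : Policy) (x : Fin n → ℝ) (d : ℕ+) : Config n m where
  x := x
  aoi := d
  len := π d
  used := 0
  payload := S.K *ᵥ (S.A ^ ((π d : ℕ) - 1) *ᵥ x)

/-- Slot `t` is the last slot of the current packet, so that detection takes place. -/
def Config.arrives (c : Config n m) : Prop := c.used + 1 = c.len

/-- `γ_t = 1`: the packet arrives in this slot and is detected without error.  Here `e l` tells
whether a packet of length `l` arriving in this slot is erroneous. -/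
def Config.success (c : Config n m) (e : ℕ+ → Bool) : Prop := c.arrives ∧ e c.len = false

open Classical in
/-- The control input applied in the slot: the payload upon success, and zero otherwise. -/
def Config.input (c : Config n m) (e : ℕ+ → Bool) : Fin m → ℝ :=
  if c.success e then c.payload else 0

/-- The next plant state, `A x + B u + w`. -/
def Config.nextX (S : Loop n m) (c : Config n m) (w : Fin n → ℝ) (e : ℕ+ → Bool) : Fin n → ℝ :=
  S.A *ᵥ c.x + S.B *ᵥ c.input e + w

open Classical in
/-- The next age of information. -/
def Config.nextAoi (c : Config n m) (e : ℕ+ → Bool) : ℕ+ :=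
  if c.success e then c.len else c.aoi + 1

open Classical in
/-- One slot of the closed loop with disturbance `w` and packet errors `e`.  When a packet has
arrived (detected or not), the next one is started in the next slot. -/
def step (S : Loop n m) (π : Policy) (w : Fin n → ℝ) (e : ℕ+ → Bool) (c : Config n m) :
    Config n m :=
  if c.arrives then newPacket S π (c.nextX S w e) (c.nextAoi e)
  else { c with x := c.nextX S w e, aoi := c.nextAoi e, used := c.used + 1 }

/-- The configuration at slot `t = 0, 1, 2, ...` when a first packet is started at slot `0` with
plant state `x₀` and age of information `d₀`, for a disturbance sequence `w` and a sequence `e` of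
packet errors. -/
def trajectory (S : Loop n m) (π : Policy) (x₀ : Fin n → ℝ) (d₀ : ℕ+)
    (w : ℕ → Fin n → ℝ) (e : ℕ → ℕ+ → Bool) : ℕ → Config n m
  | 0 => newPacket S π x₀ d₀
  | t + 1 => step S π (w t) (e t) (trajectory S π x₀ d₀ w e t)

variable {Ω : Type*} [MeasurableSpace Ω]

/-- The expected cost `E[x_tᵀ Q x_t] ∈ [0, ∞]` of slot `t` (`Q` is positive semidefinite). -/
def slotCost (P : Measure Ω) (S : Loop n m) (Q : Matrix (Fin n) (Fin n) ℝ) (x₀ : Ω → Fin n → ℝ)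
    (d₀ : ℕ+) (w : ℕ → Ω → Fin n → ℝ) (e : ℕ → Ω → ℕ+ → Bool) (π : Policy) (t : ℕ) : ℝ≥0∞ :=
  ∫⁻ ω, ENNReal.ofReal
    ((trajectory S π (x₀ ω) d₀ (fun s => w s ω) (fun s => e s ω) t).x ⬝ᵥ
      Q *ᵥ (trajectory S π (x₀ ω) d₀ (fun s => w s ω) (fun s => e s ω) t).x) ∂P

/-- The average of the expected costs of the first `T` slots. -/
def avgCost (P : Measure Ω) (S : Loop n m) (Q : Matrix (Fin n) (Fin n) ℝ) (x₀ : Ω → Fin n → ℝ)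
    (d₀ : ℕ+) (w : ℕ → Ω → Fin n → ℝ) (e : ℕ → Ω → ℕ+ → Bool) (π : Policy) (T : ℕ) : ℝ≥0∞ :=
  (∑ t ∈ Finset.range T, slotCost P S Q x₀ d₀ w e π t) / T

end

end WNCS

namespace WNCS

noncomputable section

/-! ### Independence of regrouped pairs -/

theorem _root_.ProbabilityTheory.IndepFun.prodMk_prodMk_comm {Ω α β γ δ : Type*}
    [MeasurableSpace Ω] [MeasurableSpace α] [MeasurableSpace β] [MeasurableSpace γ]
    [MeasurableSpace δ] {P : Measure Ω} [IsProbabilityMeasure P] {a : Ω → α} {b : Ω → β}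
    {c : Ω → γ} {d : Ω → δ} (ha : Measurable a) (hb : Measurable b) (hc : Measurable c)
    (hd : Measurable d) (h : IndepFun (fun ω => (a ω, b ω)) (fun ω => (c ω, d ω)) P)
    (hab : IndepFun a b P) (hcd : IndepFun c d P) :
    IndepFun (fun ω => (a ω, c ω)) (fun ω => (b ω, d ω)) P := by
  have hac : IndepFun a c P := h.comp measurable_fst measurable_fst
  have hbd : IndepFun b d P := h.comp measurable_snd measurable_snd
  rw [indepFun_iff_map_prod_eq_prod_map_map (by fun_prop) (by fun_prop)] at h hab hcd hac hbd ⊢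
  have hPa := Measure.isProbabilityMeasure_map (μ := P) ha.aemeasurable
  have hPb := Measure.isProbabilityMeasure_map (μ := P) hb.aemeasurable
  have hPc := Measure.isProbabilityMeasure_map (μ := P) hc.aemeasurable
  have hPd := Measure.isProbabilityMeasure_map (μ := P) hd.aemeasurable
  rw [hac, hbd]
  rw [hab, hcd] at h
  refine Measure.ext_of_lintegral _ fun f hf => ?_
  have e1 : Measure.map (fun ω => ((a ω, c ω), (b ω, d ω))) P =
      Measure.map (fun p : (α × β) × (γ × δ) => ((p.1.1, p.2.1), (p.1.2, p.2.2)))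
        (Measure.map (fun ω => ((a ω, b ω), (c ω, d ω))) P) := by
    rw [Measure.map_map (by fun_prop) (by fun_prop)]
    rfl
  rw [e1, h, lintegral_map hf (by fun_prop), lintegral_prod _ (by fun_prop),
    lintegral_prod _ (by fun_prop)]
  rw [lintegral_prod _ (by fun_prop), lintegral_prod _ (by fun_prop)]
  refine lintegral_congr fun x => ?_
  have e2 (y : β) : ∫⁻ p : γ × δ, f ((x, p.1), (y, p.2)) ∂(P.map c).prod (P.map d) =
      ∫⁻ u, ∫⁻ v, f ((x, u), (y, v)) ∂P.map d ∂P.map c := lintegral_prod _ (by fun_prop)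
  simp only [e2]
  rw [lintegral_lintegral_swap (by
    apply Measurable.aemeasurable
    exact Measurable.lintegral_prod_right' (f := fun p : (β × γ) × δ =>
      f ((x, p.1.2), (p.1.1, p.2))) (by fun_prop))]
  refine lintegral_congr fun y => ?_
  rw [lintegral_prod _ (by fun_prop)]

/-! ### The measurable structure of configurations -/

variable {n m : ℕ}

instance : MeasurableSpace ℕ+ := ⊤

instance : DiscreteMeasurableSpace ℕ+ := ⟨fun _ => trivial⟩

/-- A configuration as a tuple of its components. -/
def Config.toTuple (c : Config n m) : (Fin n → ℝ) × ℕ+ × ℕ+ × ℕ × (Fin m → ℝ) :=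
  (c.x, c.aoi, c.len, c.used, c.payload)

instance : MeasurableSpace (Config n m) := MeasurableSpace.comap Config.toTuple inferInstance

theorem measurable_toTuple : Measurable (Config.toTuple (n := n) (m := m)) :=
  comap_measurable _

@[fun_prop]
theorem Config.measurable_x : Measurable (Config.x (n := n) (m := m)) :=
  measurable_fst.comp measurable_toTuple

@[fun_prop]
theorem Config.measurable_aoi : Measurable (Config.aoi (n := n) (m := m)) :=
  (measurable_fst.comp measurable_snd).comp measurable_toTuple

@[fun_prop]
theorem Config.measurable_len : Measurable (Config.len (n := n) (m := m)) :=
  (measurable_fst.comp (measurable_snd.comp measurable_snd)).comp measurable_toTuple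

@[fun_prop]
theorem Config.measurable_used : Measurable (Config.used (n := n) (m := m)) :=
  (measurable_fst.comp (measurable_snd.comp (measurable_snd.comp measurable_snd))).comp
    measurable_toTuple

@[fun_prop]
theorem Config.measurable_payload : Measurable (Config.payload (n := n) (m := m)) :=
  (measurable_snd.comp (measurable_snd.comp (measurable_snd.comp measurable_snd))).comp
    measurable_toTuple

theorem Config.measurable_mk {α : Type*} [MeasurableSpace α] {x : α → Fin n → ℝ} {d l : α → ℕ+}
    {u : α → ℕ} {p : α → Fin m → ℝ} (hx : Measurable x) (hd : Measurable d) (hl : Measurable l)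
    (hu : Measurable u) (hp : Measurable p) :
    Measurable fun a => (⟨x a, d a, l a, u a, p a⟩ : Config n m) := by
  refine measurable_comap_iff.2 ?_
  exact hx.prodMk (hd.prodMk (hl.prodMk (hu.prodMk hp)))

theorem measurable_mulVec {ι κ : Type*} [Fintype ι] [Fintype κ] (M : Matrix ι κ ℝ) :
    Measurable fun x : κ → ℝ => M *ᵥ x :=
  (Continuous.matrix_mulVec continuous_const continuous_id).measurable

theorem measurable_newPacket (S : Loop n m) (π : Policy) :
    Measurable fun p : (Fin n → ℝ) × ℕ+ => newPacket S π p.1 p.2 := by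
  have h1 : Measurable fun p : (Fin n → ℝ) × ℕ+ => π p.2 :=
    (Measurable.of_discrete (f := π)).comp measurable_snd
  have h2 : Measurable fun p : (Fin n → ℝ) × ℕ+ =>
      S.K *ᵥ (S.A ^ ((π p.2 : ℕ) - 1) *ᵥ p.1) :=
    measurable_from_prod_countable_left fun d =>
      (measurable_mulVec S.K).comp (measurable_mulVec (S.A ^ ((π d : ℕ) - 1)))
  exact Config.measurable_mk measurable_fst measurable_snd h1 measurable_const h2

theorem measurableSet_arrives : MeasurableSet {c : Config n m | c.arrives} := by
  have h : Measurable fun c : Config n m => (c.used, c.len) := by fun_prop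
  exact h (MeasurableSet.of_discrete (s := {p : ℕ × ℕ+ | p.1 + 1 = p.2}))

theorem measurableSet_success (b : Bool) :
    MeasurableSet {c : Config n m | c.success fun _ => b} := by
  cases b
  · simpa [Config.success] using measurableSet_arrives
  · simp [Config.success]

theorem measurable_step (S : Loop n m) (π : Policy) (b : Bool) :
    Measurable fun p : (Fin n → ℝ) × Config n m => step S π p.1 (fun _ => b) p.2 := by
  classical
  have hs : MeasurableSet {p : (Fin n → ℝ) × Config n m | p.2.success fun _ => b} :=
    measurable_snd (measurableSet_success b)
  have hX : Measurable fun p : (Fin n → ℝ) × Config n m => p.2.nextX S p.1 fun _ => b := by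
    unfold Config.nextX Config.input
    refine (((measurable_mulVec _).comp (by fun_prop)).add
      ((measurable_mulVec _).comp (Measurable.ite hs (by fun_prop) measurable_const))).add
      measurable_fst
  have hA : Measurable fun p : (Fin n → ℝ) × Config n m => p.2.nextAoi fun _ => b := by
    unfold Config.nextAoi
    exact Measurable.ite hs (by fun_prop)
      ((Measurable.of_discrete (f := fun d : ℕ+ => d + 1)).comp (by fun_prop))
  unfold step
  refine Measurable.ite (measurable_snd measurableSet_arrives) ?_ ?_
  · exact (measurable_newPacket S π).comp (hX.prodMk hA)
  · exact Config.measurable_mk hX hA (by fun_prop)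
      ((Measurable.of_discrete (f := fun d : ℕ => d + 1)).comp (by fun_prop)) (by fun_prop)

theorem step_eq_const (S : Loop n m) (π : Policy) (w : Fin n → ℝ) (e : ℕ+ → Bool)
    (c : Config n m) : step S π w e c = step S π w (fun _ => e c.len) c := by
  rfl

theorem measurable_step_errors (S : Loop n m) (π : Policy) :
    Measurable fun p : Config n m × (Fin n → ℝ) × (ℕ+ → Bool) => step S π p.2.1 p.2.2 p.1 := by
  have h1 : Measurable fun p : ((Fin n → ℝ) × Config n m) × Bool =>
      step S π p.1.1 (fun _ => p.2) p.1.2 :=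
    measurable_from_prod_countable_left fun b => measurable_step S π b
  have h2 : Measurable fun p : (ℕ+ → Bool) × ℕ+ => p.1 p.2 :=
    measurable_from_prod_countable_left fun l => measurable_pi_apply l
  have h3 : Measurable fun p : Config n m × (Fin n → ℝ) × (ℕ+ → Bool) => p.2.2 p.1.len :=
    h2.comp (show Measurable fun p : Config n m × (Fin n → ℝ) × (ℕ+ → Bool) =>
      (p.2.2, p.1.len) by fun_prop)
  exact h1.comp (show Measurable fun p : Config n m × (Fin n → ℝ) × (ℕ+ → Bool) =>
    ((p.2.1, p.1), p.2.2 p.1.len) by fun_prop)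

/-! ### The transfer operator -/

/-- The expectation of `F` after one slot, as a function of the configuration at the beginning of
the slot, when the disturbance has law `N` and packet errors have probabilities `g`. -/
def transfer (S : Loop n m) (π : Policy) (N : Measure (Fin n → ℝ)) (g : ℕ+ → ℝ)
    (F : Config n m → ℝ≥0∞) (c : Config n m) : ℝ≥0∞ :=
  ENNReal.ofReal (g c.len) * ∫⁻ w, F (step S π w (fun _ => true) c) ∂N +
    ENNReal.ofReal (1 - g c.len) * ∫⁻ w, F (step S π w (fun _ => false) c) ∂N

theorem measurable_transfer (S : Loop n m) (π : Policy) (N : Measure (Fin n → ℝ)) [SFinite N]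
    (g : ℕ+ → ℝ) {F : Config n m → ℝ≥0∞} (hF : Measurable F) :
    Measurable (transfer S π N g F) := by
  have h (b : Bool) : Measurable fun c : Config n m =>
      ∫⁻ w, F (step S π w (fun _ => b) c) ∂N :=
    Measurable.lintegral_prod_left' (f := fun p : (Fin n → ℝ) × Config n m =>
      F (step S π p.1 (fun _ => b) p.2)) (hF.comp (measurable_step S π b))
  have hl (f : ℕ+ → ℝ≥0∞) : Measurable fun c : Config n m => f c.len :=
    (Measurable.of_discrete (f := f)).comp Config.measurable_len
  exact ((hl fun l => ENNReal.ofReal (g l)).mul (h true)).add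
    ((hl fun l => ENNReal.ofReal (1 - g l)).mul (h false))

theorem measurable_transfer_iterate (S : Loop n m) (π : Policy) (N : Measure (Fin n → ℝ))
    [SFinite N] (g : ℕ+ → ℝ) {F : Config n m → ℝ≥0∞} (hF : Measurable F) (t : ℕ) :
    Measurable ((transfer S π N g)^[t] F) := by
  induction t with
  | zero => exact hF
  | succ t ih =>
    rw [Function.iterate_succ_apply']
    exact measurable_transfer S π N g ih

theorem trajectory_congr (S : Loop n m) (π : Policy) (x₀ : Fin n → ℝ) (d₀ : ℕ+)
    {w w' : ℕ → Fin n → ℝ} {e e' : ℕ → ℕ+ → Bool} (t : ℕ) (hw : ∀ s < t, w s = w' s)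
    (he : ∀ s < t, e s = e' s) :
    trajectory S π x₀ d₀ w e t = trajectory S π x₀ d₀ w' e' t := by
  induction t with
  | zero => rfl
  | succ t ih =>
    simp only [trajectory]
    rw [ih (fun s hs => hw s (by omega)) (fun s hs => he s (by omega)), hw t (by omega),
      he t (by omega)]

theorem measurable_trajectory (S : Loop n m) (π : Policy) (d₀ : ℕ+) (t : ℕ) :
    Measurable fun p : (Fin n → ℝ) × (ℕ → Fin n → ℝ) × (ℕ → ℕ+ → Bool) =>
      trajectory S π p.1 d₀ p.2.1 p.2.2 t := by
  induction t with
  | zero =>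
    exact (measurable_newPacket S π).comp (measurable_fst.prodMk measurable_const)
  | succ t ih =>
    have h : Measurable fun p : (Fin n → ℝ) × (ℕ → Fin n → ℝ) × (ℕ → ℕ+ → Bool) =>
        (p.2.1 t, p.2.2 t) := by fun_prop
    exact (measurable_step_errors S π).comp (ih.prodMk h)

section chain

variable {Ω : Type*} [MeasurableSpace Ω] {P : Measure Ω} [IsProbabilityMeasure P]
  {x₀ : Ω → Fin n → ℝ} {w : ℕ → Ω → Fin n → ℝ} {e : ℕ → Ω → ℕ+ → Bool}

theorem indepFun_trajectory (S : Loop n m) (π : Policy) (d₀ : ℕ+) (hx₀ : Measurable x₀)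
    (hw : ∀ t, Measurable (w t)) (hwind : iIndepFun w P) (he : ∀ t, Measurable (e t))
    (heind : iIndepFun e P) (hind₁ : IndepFun (fun ω t => w t ω) (fun ω t => e t ω) P)
    (hind₂ : IndepFun x₀ (fun ω => ((fun t => w t ω), (fun t => e t ω))) P) (t : ℕ) :
    IndepFun (fun ω => trajectory S π (x₀ ω) d₀ (fun s => w s ω) (fun s => e s ω) t)
      (fun ω => (w t ω, e t ω)) P := by
  classical
  let I := Finset.range t
  let Wp : Ω → I → Fin n → ℝ := fun ω i => w i ω
  let Ep : Ω → I → ℕ+ → Bool := fun ω i => e i ω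
  have hWp : Measurable Wp := measurable_pi_lambda _ fun i => hw i
  have hEp : Measurable Ep := measurable_pi_lambda _ fun i => he i
  have hdisj : Disjoint I {t} := by simp [I]
  have h1 : IndepFun Wp (w t) P :=
    (hwind.indepFun_finset I {t} hdisj hw).comp measurable_id
      (measurable_pi_apply (⟨t, by simp⟩ : ({t} : Finset ℕ)))
  have h2 : IndepFun Ep (e t) P :=
    (heind.indepFun_finset I {t} hdisj he).comp measurable_id
      (measurable_pi_apply (⟨t, by simp⟩ : ({t} : Finset ℕ)))
  have hr : Measurable fun f : ℕ → Fin n → ℝ => ((fun i : I => f i), f t) := by fun_prop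
  have hr' : Measurable fun f : ℕ → ℕ+ → Bool => ((fun i : I => f i), f t) := by fun_prop
  have h3 : IndepFun (fun ω => (Wp ω, Ep ω)) (fun ω => (w t ω, e t ω)) P :=
    IndepFun.prodMk_prodMk_comm hWp (hw t) hEp (he t) (hind₁.comp hr hr') h1 h2
  have hr2 : Measurable fun p : (ℕ → Fin n → ℝ) × (ℕ → ℕ+ → Bool) =>
    ((((fun i : I => p.1 i), (fun i : I => p.2 i))), (p.1 t, p.2 t)) := by fun_prop
  have h4 : IndepFun (fun ω => (x₀ ω, ((Wp ω, Ep ω)))) (fun ω => ((), (w t ω, e t ω))) P :=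
    IndepFun.prodMk_prodMk_comm hx₀ measurable_const (hWp.prodMk hEp) ((hw t).prodMk (he t))
      (hind₂.comp (φ := fun x => (x, ())) (by fun_prop) hr2) (indepFun_const_right _ _) h3
  let ext : (Fin n → ℝ) × (I → Fin n → ℝ) × (I → ℕ+ → Bool) →
      (Fin n → ℝ) × (ℕ → Fin n → ℝ) × (ℕ → ℕ+ → Bool) := fun p =>
    (p.1, (fun s => if h : s ∈ I then p.2.1 ⟨s, h⟩ else 0),
      (fun s => if h : s ∈ I then p.2.2 ⟨s, h⟩ else fun _ => true))
  have hext : Measurable ext := by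
    refine measurable_fst.prodMk (Measurable.prodMk ?_ ?_)
    · refine measurable_pi_lambda _ fun s => ?_
      by_cases h : s ∈ I
      · simp only [h, dite_true]; fun_prop
      · simp only [h, dite_false]; fun_prop
    · refine measurable_pi_lambda _ fun s => ?_
      by_cases h : s ∈ I
      · simp only [h, dite_true]; fun_prop
      · simp only [h, dite_false]; fun_prop
  have h5 := h4.comp ((measurable_trajectory S π d₀ t).comp hext) measurable_snd
  have h6 : (fun ω => trajectory S π (x₀ ω) d₀ (fun s => w s ω) (fun s => e s ω) t) =
      ((fun p : (Fin n → ℝ) × (ℕ → Fin n → ℝ) × (ℕ → ℕ+ → Bool) =>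
        trajectory S π p.1 d₀ p.2.1 p.2.2 t) ∘ ext) ∘ fun ω => (x₀ ω, Wp ω, Ep ω) := by
    ext1 ω
    refine trajectory_congr S π _ d₀ t (fun s hs => ?_) (fun s hs => ?_)
    · simp [I, Wp, ext, hs]
    · simp [I, Ep, ext, hs]
  rw [h6]
  exact h5

theorem lintegral_errors {g : ℕ+ → ℝ} {f : Ω → ℕ+ → Bool} (hf : Measurable f) (l : ℕ+)
    (hprob : P.real {ω | f ω l = true} = g l) (φ : Bool → ℝ≥0∞) :
    ∫⁻ ω, φ (f ω l) ∂P = ENNReal.ofReal (g l) * φ true + ENNReal.ofReal (1 - g l) * φ false := by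
  have hm : MeasurableSet {ω | f ω l = true} :=
    ((measurable_pi_apply l).comp hf) (MeasurableSet.of_discrete (s := {true}))
  have hP : P {ω | f ω l = true} = ENNReal.ofReal (g l) := by
    rw [← hprob, ofReal_measureReal]
  have hP' : P {ω | f ω l = true}ᶜ = ENNReal.ofReal (1 - g l) := by
    rw [← hprob, ← probReal_compl_eq_one_sub hm, ofReal_measureReal]
  rw [← lintegral_add_compl _ hm, ← hP, ← hP']
  congr 1
  · rw [setLIntegral_congr_fun (g := fun _ => φ true) hm (by
      intro ω hω
      simp only [Set.mem_ofPred_eq] at hω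
      simp [hω])]
    simp [mul_comm]
  · rw [setLIntegral_congr_fun (g := fun _ => φ false) hm.compl (by
      intro ω hω
      simp only [Set.mem_compl_iff, Set.mem_ofPred_eq, Bool.not_eq_true] at hω
      simp [hω])]
    simp [mul_comm]

theorem lintegral_trajectory (S : Loop n m) (π : Policy) (d₀ : ℕ+) (hx₀ : Measurable x₀)
    (hw : ∀ t, Measurable (w t)) (hwind : iIndepFun w P) (he : ∀ t, Measurable (e t))
    (heind : iIndepFun e P) (hind₁ : IndepFun (fun ω t => w t ω) (fun ω t => e t ω) P)
    (hind₂ : IndepFun x₀ (fun ω => ((fun t => w t ω), (fun t => e t ω))) P)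
    {N : Measure (Fin n → ℝ)} (hN : ∀ t, P.map (w t) = N) {g : ℕ+ → ℝ}
    (hprob : ∀ t l, P.real {ω | e t ω l = true} = g l) (t : ℕ) {F : Config n m → ℝ≥0∞}
    (hF : Measurable F) :
    ∫⁻ ω, F (trajectory S π (x₀ ω) d₀ (fun s => w s ω) (fun s => e s ω) t) ∂P =
      ∫⁻ ω, (transfer S π N g)^[t] F (newPacket S π (x₀ ω) d₀) ∂P := by
  have hNP : IsProbabilityMeasure N :=
    hN 0 ▸ Measure.isProbabilityMeasure_map (hw 0).aemeasurable
  induction t generalizing F with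
  | zero => rfl
  | succ t ih =>
    rw [Function.iterate_succ_apply, ← ih (measurable_transfer S π N g hF)]
    set c : Ω → Config n m := fun ω =>
      trajectory S π (x₀ ω) d₀ (fun s => w s ω) (fun s => e s ω) t with hc
    have hcm : Measurable c := (measurable_trajectory S π d₀ t).comp
      (f := fun ω => (x₀ ω, (fun s => w s ω), (fun s => e s ω))) (by fun_prop)
    have hci : IndepFun c (fun ω => (w t ω, e t ω)) P := indepFun_trajectory S π d₀ hx₀ hw hwind he heind hind₁ hind₂ t
    have hwe : IndepFun (w t) (e t) P :=
      hind₁.comp (measurable_pi_apply t) (measurable_pi_apply t)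
    rw [indepFun_iff_map_prod_eq_prod_map_map (by fun_prop) (by fun_prop)] at hci hwe
    rw [hwe, hN t] at hci
    have hPe := Measure.isProbabilityMeasure_map (μ := P) (he t).aemeasurable
    have hPc := Measure.isProbabilityMeasure_map (μ := P) hcm.aemeasurable
    have hG : Measurable fun p : Config n m × (Fin n → ℝ) × (ℕ+ → Bool) =>
      F (step S π p.2.1 p.2.2 p.1) := hF.comp (measurable_step_errors S π)
    calc ∫⁻ ω, F (step S π (w t ω) (e t ω) (c ω)) ∂P
        = ∫⁻ p, F (step S π p.2.1 p.2.2 p.1) ∂(P.map fun ω => (c ω, (w t ω, e t ω))) := by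
          rw [lintegral_map hG (by fun_prop)]
      _ = ∫⁻ c', ∫⁻ w', ∫⁻ ω, F (step S π w' (e t ω) c') ∂P ∂N ∂(P.map c) := by
          rw [hci, lintegral_prod _ hG.aemeasurable]
          refine lintegral_congr fun c' => ?_
          have hGc : Measurable fun y : (Fin n → ℝ) × (ℕ+ → Bool) => F (step S π y.1 y.2 c') :=
            hG.comp (f := fun y => (c', y)) (by fun_prop)
          refine (lintegral_prod _ hGc.aemeasurable).trans (lintegral_congr fun w' => ?_)
          have hGw : Measurable fun e' : ℕ+ → Bool => F (step S π w' e' c') :=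
            hGc.comp (f := fun e' => (w', e')) (by fun_prop)
          exact lintegral_map hGw (he t)
      _ = ∫⁻ c', transfer S π N g F c' ∂(P.map c) := by
          refine lintegral_congr fun c' => ?_
          have hb (b : Bool) : Measurable fun w' => F (step S π w' (fun _ => b) c') :=
            hF.comp ((measurable_step S π b).comp (f := fun w' => (w', c')) (by fun_prop))
          have h6 (w' : Fin n → ℝ) : ∫⁻ ω, F (step S π w' (e t ω) c') ∂P =
              ENNReal.ofReal (g c'.len) * F (step S π w' (fun _ => true) c') +
              ENNReal.ofReal (1 - g c'.len) * F (step S π w' (fun _ => false) c') := by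
            rw [← lintegral_errors (he t) c'.len (hprob t c'.len)
              fun b => F (step S π w' (fun _ => b) c')]
            refine lintegral_congr fun ω => ?_
            rw [step_eq_const]
          simp_rw [h6]
          rw [lintegral_add_left ((hb true).const_mul _), lintegral_const_mul _ (hb true),
            lintegral_const_mul _ (hb false)]
          rfl
      _ = ∫⁻ ω, transfer S π N g F (c ω) ∂P :=
          lintegral_map (measurable_transfer S π N g hF) hcm

end chain

/-! ### Squared lengths and centred noise -/

/-- The squared Euclidean length as an extended nonnegative number. -/
def normSq {ι : Type*} [Fintype ι] (y : ι → ℝ) : ℝ≥0∞ := ENNReal.ofReal (y ⬝ᵥ y)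

theorem dotProduct_self_nonneg_real {ι : Type*} [Fintype ι] (y : ι → ℝ) : 0 ≤ y ⬝ᵥ y :=
  Finset.sum_nonneg fun i _ => mul_self_nonneg (y i)

@[fun_prop]
theorem measurable_normSq {ι : Type*} [Fintype ι] : Measurable (normSq (ι := ι)) := by
  unfold normSq dotProduct
  fun_prop

/-- A centred probability law on `ℝⁿ` with finite second moments. -/
structure IsNoise (N : Measure (Fin n → ℝ)) : Prop where
  prob : IsProbabilityMeasure N
  memLp : ∀ i, MemLp (fun w : Fin n → ℝ => w i) 2 N
  mean : ∀ i, ∫ w, w i ∂N = 0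

/-- The expected squared length of `M w` for a disturbance `w`. -/
def noiseGain (N : Measure (Fin n → ℝ)) {ι : Type*} [Fintype ι] (M : Matrix ι (Fin n) ℝ) : ℝ≥0∞ :=
  ∫⁻ w, normSq (M *ᵥ w) ∂N

namespace IsNoise

variable {N : Measure (Fin n → ℝ)} (hN : IsNoise N) {ι : Type*} [Fintype ι]
include hN

theorem memLp_dotProduct (a : Fin n → ℝ) : MemLp (fun w => a ⬝ᵥ w) 2 N := by
  unfold dotProduct
  exact memLp_finsetSum _ fun i _ => (hN.memLp i).const_mul (a i)

theorem integral_dotProduct (a : Fin n → ℝ) : ∫ w, a ⬝ᵥ w ∂N = 0 := by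
  have := hN.prob
  unfold dotProduct
  rw [integral_finsetSum _ fun i _ => ((hN.memLp i).integrable (by norm_num)).const_mul _]
  simp [integral_const_mul, hN.mean]

theorem integrable_mulVec_sq (M : Matrix ι (Fin n) ℝ) :
    Integrable (fun w => (M *ᵥ w) ⬝ᵥ (M *ᵥ w)) N := by
  refine integrable_finsetSum _ fun i _ => ?_
  have h := (hN.memLp_dotProduct (M i)).integrable_sq
  simp only [pow_two] at h
  exact h

theorem noiseGain_eq (M : Matrix ι (Fin n) ℝ) :
    noiseGain N M = ENNReal.ofReal (∫ w, (M *ᵥ w) ⬝ᵥ (M *ᵥ w) ∂N) :=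
  (ofReal_integral_eq_lintegral_ofReal (hN.integrable_mulVec_sq M)
    (Eventually.of_forall fun _ => dotProduct_self_nonneg_real _)).symm

theorem noiseGain_ne_top (M : Matrix ι (Fin n) ℝ) : noiseGain N M ≠ ∞ := by
  rw [hN.noiseGain_eq]
  exact ENNReal.ofReal_ne_top

theorem lintegral_normSq_add (b : ι → ℝ) (M : Matrix ι (Fin n) ℝ) :
    ∫⁻ w, normSq (b + M *ᵥ w) ∂N = normSq b + noiseGain N M := by
  have := hN.prob
  have hI := hN.integrable_mulVec_sq M
  have hL (w : Fin n → ℝ) : b ⬝ᵥ M *ᵥ w = (b ᵥ* M) ⬝ᵥ w := Matrix.dotProduct_mulVec _ _ _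
  have hI1 : Integrable (fun w => 2 * (b ⬝ᵥ M *ᵥ w)) N := by
    simp only [hL]
    exact ((hN.memLp_dotProduct _).integrable (by norm_num)).const_mul 2
  have h1 (w : Fin n → ℝ) : (b + M *ᵥ w) ⬝ᵥ (b + M *ᵥ w) =
      b ⬝ᵥ b + 2 * (b ⬝ᵥ M *ᵥ w) + (M *ᵥ w) ⬝ᵥ (M *ᵥ w) := by
    rw [add_dotProduct, dotProduct_add, dotProduct_add, dotProduct_comm (M *ᵥ w) b]
    ring
  have hI2 : Integrable (fun w => b ⬝ᵥ b + 2 * (b ⬝ᵥ M *ᵥ w)) N :=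
    (integrable_const _).add hI1
  unfold normSq
  rw [← ofReal_integral_eq_lintegral_ofReal (by simp only [h1]; exact hI2.add hI)
    (Eventually.of_forall fun _ => dotProduct_self_nonneg_real _), hN.noiseGain_eq,
    ← ENNReal.ofReal_add (dotProduct_self_nonneg_real _)
      (integral_nonneg fun _ => dotProduct_self_nonneg_real _)]
  simp only [h1]
  rw [integral_add hI2 hI, integral_add (integrable_const _) hI1]
  simp [integral_const_mul, hL, hN.integral_dotProduct]

end IsNoise

/-! ### The transfer operator on quadratic functions -/

theorem mulVec_pow_step {ι : Type*} (A : Matrix (Fin n) (Fin n) ℝ) (M : Matrix ι (Fin n) ℝ) (r : ℕ)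
    (x w : Fin n → ℝ) :
    M *ᵥ (A ^ r *ᵥ (A *ᵥ x + w)) = M *ᵥ (A ^ (r + 1) *ᵥ x) + (M * A ^ r) *ᵥ w := by
  rw [Matrix.mulVec_add, Matrix.mulVec_add, Matrix.mulVec_mulVec, Matrix.mulVec_mulVec,
    Matrix.mulVec_mulVec, Matrix.mulVec_mulVec, pow_succ, Matrix.mul_assoc]

section transfer

variable {S : Loop n m} {π : Policy} {N : Measure (Fin n → ℝ)} {g : ℕ+ → ℝ}

theorem transfer_of_not_arrives (hg0 : ∀ l, 0 ≤ g l) (hg1 : ∀ l, g l ≤ 1)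
    (F : Config n m → ℝ≥0∞) {c : Config n m} (hc : ¬ c.arrives) :
    transfer S π N g F c =
      ∫⁻ w, F ⟨S.A *ᵥ c.x + w, c.aoi + 1, c.len, c.used + 1, c.payload⟩ ∂N := by
  have h (b : Bool) : ¬ c.success fun _ => b := fun h => hc h.1
  have hs (w : Fin n → ℝ) (b : Bool) : step S π w (fun _ => b) c =
      ⟨S.A *ᵥ c.x + w, c.aoi + 1, c.len, c.used + 1, c.payload⟩ := by
    simp [step, hc, Config.nextX, Config.nextAoi, Config.input, h]
  simp only [transfer, hs]
  rw [← add_mul, ← ENNReal.ofReal_add (hg0 _) (sub_nonneg.2 (hg1 _))]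
  simp

theorem transfer_of_arrives (F : Config n m → ℝ≥0∞) {c : Config n m} (hc : c.arrives) :
    transfer S π N g F c =
      ENNReal.ofReal (g c.len) * ∫⁻ w, F (newPacket S π (S.A *ᵥ c.x + w) (c.aoi + 1)) ∂N +
      ENNReal.ofReal (1 - g c.len) *
        ∫⁻ w, F (newPacket S π (S.A *ᵥ c.x + S.B *ᵥ c.payload + w) c.len) ∂N := by
  have h1 : ¬ c.success fun _ => true := fun h => by simpa using h.2
  have h2 : c.success fun _ => false := ⟨hc, rfl⟩
  simp [transfer, step, hc, Config.nextX, Config.nextAoi, Config.input, h1, h2]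

/-- The expected squared length of `M x`, where `x` is the state after the arrival, `r` slots
ahead, of the current packet if there were no disturbances. -/
def arrivalSq (S : Loop n m) (g : ℕ+ → ℝ) {ι : Type*} [Fintype ι] (M : Matrix ι (Fin n) ℝ) (r : ℕ)
    (c : Config n m) : ℝ≥0∞ :=
  ENNReal.ofReal (g c.len) * normSq (M *ᵥ (S.A ^ r *ᵥ c.x)) +
    ENNReal.ofReal (1 - g c.len) * normSq (M *ᵥ (S.A ^ r *ᵥ c.x + S.B *ᵥ c.payload))

variable {ι : Type*} [Fintype ι]

theorem lintegral_arrivalSq (hN : IsNoise N) (hg0 : ∀ l, 0 ≤ g l) (hg1 : ∀ l, g l ≤ 1)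
    (M : Matrix ι (Fin n) ℝ) (r : ℕ) (c : Config n m) :
    ∫⁻ w, arrivalSq S g M r ⟨S.A *ᵥ c.x + w, c.aoi + 1, c.len, c.used + 1, c.payload⟩ ∂N =
      arrivalSq S g M (r + 1) c + noiseGain N (M * S.A ^ r) := by
  have h2 (w : Fin n → ℝ) : M *ᵥ (S.A ^ r *ᵥ (S.A *ᵥ c.x + w) + S.B *ᵥ c.payload) =
      M *ᵥ (S.A ^ (r + 1) *ᵥ c.x + S.B *ᵥ c.payload) + (M * S.A ^ r) *ᵥ w := by
    rw [Matrix.mulVec_add, mulVec_pow_step, Matrix.mulVec_add]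
    abel
  have hm (b : ι → ℝ) : Measurable fun w : Fin n → ℝ => normSq (b + (M * S.A ^ r) *ᵥ w) :=
    measurable_normSq.comp ((measurable_mulVec _).const_add b)
  simp only [arrivalSq, mulVec_pow_step, h2]
  rw [lintegral_add_left ((hm _).const_mul _), lintegral_const_mul _ (hm _),
    lintegral_const_mul _ (hm _), hN.lintegral_normSq_add, hN.lintegral_normSq_add, mul_add,
    mul_add]
  rw [add_add_add_comm, ← add_mul, ← ENNReal.ofReal_add (hg0 _) (sub_nonneg.2 (hg1 _))]
  simp

theorem transfer_eq_of_newPacket (hN : IsNoise N) (hg0 : ∀ l, 0 ≤ g l) (hg1 : ∀ l, g l ≤ 1)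
    (M : Matrix ι (Fin n) ℝ) (a b : ℝ≥0∞) {F : Config n m → ℝ≥0∞}
    (hF : ∀ x d, F (newPacket S π x d) = a * normSq (M *ᵥ x) + b) {c : Config n m}
    (hc : c.arrives) :
    transfer S π N g F c = a * (arrivalSq S g M 1 c + noiseGain N M) + b := by
  have := hN.prob
  have hm (y : ι → ℝ) : Measurable fun w : Fin n → ℝ => normSq (y + M *ᵥ w) :=
    measurable_normSq.comp ((measurable_mulVec _).const_add y)
  rw [transfer_of_arrives F hc]
  simp only [hF, Matrix.mulVec_add M _ _]
  have h (y : ι → ℝ) : ∫⁻ w, (a * normSq (y + M *ᵥ w) + b) ∂N =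
      a * (normSq y + noiseGain N M) + b := by
    rw [lintegral_add_left ((hm _).const_mul _), lintegral_const_mul _ (hm _),
      hN.lintegral_normSq_add]
    simp
  rw [h, h]
  have h1 : ENNReal.ofReal (g c.len) + ENNReal.ofReal (1 - g c.len) = 1 := by
    rw [← ENNReal.ofReal_add (hg0 _) (sub_nonneg.2 (hg1 _))]
    simp
  calc _ = a * (ENNReal.ofReal (g c.len) * normSq (M *ᵥ S.A *ᵥ c.x) +
        ENNReal.ofReal (1 - g c.len) * normSq (M *ᵥ S.A *ᵥ c.x + M *ᵥ S.B *ᵥ c.payload)) +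
        (ENNReal.ofReal (g c.len) + ENNReal.ofReal (1 - g c.len)) * (a * noiseGain N M + b) := by
        ring
    _ = _ := by
        rw [h1, arrivalSq, pow_one, Matrix.mulVec_add]
        ring

theorem le_transfer_of_newPacket (hN : IsNoise N) (hg0 : ∀ l, 0 ≤ g l) (hg1 : ∀ l, g l ≤ 1)
    (M : Matrix ι (Fin n) ℝ) (a b : ℝ≥0∞) {F : Config n m → ℝ≥0∞}
    (hF : ∀ x d, a * normSq (M *ᵥ x) + b ≤ F (newPacket S π x d)) {c : Config n m}
    (hc : c.arrives) :
    a * (arrivalSq S g M 1 c + noiseGain N M) + b ≤ transfer S π N g F c := by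
  rw [← transfer_eq_of_newPacket (S := S) (π := π) hN hg0 hg1 M a b
    (F := fun c => a * normSq (M *ᵥ c.x) + b) (fun _ _ => rfl) hc,
    transfer_of_arrives _ hc, transfer_of_arrives _ hc]
  gcongr <;> exact hF _ _

end transfer

/-! ### Growth of the second moment along an unstable mode -/

theorem not_arrives_of_used_add {c : Config n m} {r : ℕ} (hc : c.used + (r + 1) = c.len)
    (hr : 1 ≤ r) : ¬ c.arrives := by
  unfold Config.arrives
  omega

theorem used_lt_len_trajectory (S : Loop n m) (π : Policy) (x₀ : Fin n → ℝ) (d₀ : ℕ+)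
    (w : ℕ → Fin n → ℝ) (e : ℕ → ℕ+ → Bool) (t : ℕ) :
    (trajectory S π x₀ d₀ w e t).used < (trajectory S π x₀ d₀ w e t).len := by
  induction t with
  | zero => exact (π d₀).pos
  | succ t ih =>
    simp only [trajectory]
    unfold step
    split_ifs with h
    · exact PNat.pos _
    · unfold Config.arrives at h
      simp only
      omega

section growth

variable {S : Loop n m} {π : Policy} {N : Measure (Fin n → ℝ)} {g : ℕ+ → ℝ}
  {ι : Type*} [Fintype ι] {L : Matrix ι (Fin n) ℝ}

theorem lintegral_normSq_step (hN : IsNoise N) (A : Matrix (Fin n) (Fin n) ℝ)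
    (M : Matrix ι (Fin n) ℝ) (x : Fin n → ℝ) :
    ∫⁻ w, normSq (M *ᵥ (A *ᵥ x + w)) ∂N = normSq (M *ᵥ (A *ᵥ x)) + noiseGain N M := by
  simp only [Matrix.mulVec_add]
  exact hN.lintegral_normSq_add _ _

theorem normSq_le_pow (hg1 : ∀ l, g l ≤ 1)
    (hL : ∀ (l : ℕ+) x, normSq (L *ᵥ x) ≤
      ENNReal.ofReal (g l) * normSq (L *ᵥ (S.A ^ (l : ℕ) *ᵥ x))) (r : ℕ) (x : Fin n → ℝ) :
    normSq (L *ᵥ x) ≤ normSq (L *ᵥ (S.A ^ r *ᵥ x)) := by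
  rcases Nat.eq_zero_or_pos r with rfl | hr
  · simp
  · refine (hL ⟨r, hr⟩ x).trans ?_
    refine mul_le_of_le_one_left' ?_
    exact ENNReal.ofReal_le_one.2 (hg1 _)

theorem noiseGain_le_pow (hg1 : ∀ l, g l ≤ 1)
    (hL : ∀ (l : ℕ+) x, normSq (L *ᵥ x) ≤
      ENNReal.ofReal (g l) * normSq (L *ᵥ (S.A ^ (l : ℕ) *ᵥ x))) (r : ℕ) :
    noiseGain N L ≤ noiseGain N (L * S.A ^ r) := by
  unfold noiseGain
  refine lintegral_mono fun w => ?_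
  simp only [← Matrix.mulVec_mulVec]
  exact normSq_le_pow hg1 hL r w

theorem arrivalSq_le_iterate (hN : IsNoise N) (hg0 : ∀ l, 0 ≤ g l) (hg1 : ∀ l, g l ≤ 1)
    {F : Config n m → ℝ≥0∞} (hF : ∀ x d, normSq (L *ᵥ x) ≤ F (newPacket S π x d)) {r : ℕ}
    (hr : 1 ≤ r) {c : Config n m} (hc : c.used + r = c.len) :
    arrivalSq S g L r c ≤ (transfer S π N g)^[r] F c := by
  induction r, hr using Nat.le_induction generalizing c with
  | base =>
    refine le_trans ?_ (le_transfer_of_newPacket hN hg0 hg1 L 1 0 (by simpa using hF) hc)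
    simp
  | succ r hr ih =>
    rw [Function.iterate_succ_apply',
      transfer_of_not_arrives hg0 hg1 _ (not_arrives_of_used_add hc hr)]
    refine le_trans (le_trans le_self_add (lintegral_arrivalSq hN hg0 hg1 L r c).ge) ?_
    refine lintegral_mono fun w => ih ?_
    simp only
    omega

/-- `F` is at least the squared length of `L x` when a packet starts or has more than `n` slots to
go.  Then its expectation, summed over a window of `n + 1` slots, grows linearly. -/
theorem add_mul_noiseGain_le_iterate (hN : IsNoise N) (hg0 : ∀ l, 0 ≤ g l) (hg1 : ∀ l, g l ≤ 1)
    (hL : ∀ (l : ℕ+) x, normSq (L *ᵥ x) ≤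
      ENNReal.ofReal (g l) * normSq (L *ᵥ (S.A ^ (l : ℕ) *ᵥ x)))
    {F : Config n m → ℝ≥0∞} (hF : ∀ x d, normSq (L *ᵥ x) ≤ F (newPacket S π x d))
    (hF' : ∀ c : Config n m, c.used + n < c.len → normSq (L *ᵥ c.x) ≤ F c) (k : ℕ)
    {c : Config n m} {r : ℕ} (hr : 1 ≤ r) (hc : c.used + r = c.len) :
    (k + n < r → normSq (L *ᵥ c.x) + k * noiseGain N L ≤
      (transfer S π N g)^[k] (fun c => ∑ i ∈ Finset.range (n + 1), (transfer S π N g)^[i] F c) c) ∧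
    (r ≤ k + n → arrivalSq S g L r c + k * noiseGain N L ≤
      (transfer S π N g)^[k]
        (fun c => ∑ i ∈ Finset.range (n + 1), (transfer S π N g)^[i] F c) c) := by
  have := hN.prob
  have hnew (x : Fin n → ℝ) (d : ℕ+) :
      normSq (L *ᵥ x) ≤ arrivalSq S g L (π d) (newPacket S π x d) :=
    (hL (π d) x).trans le_self_add
  induction k generalizing c r with
  | zero =>
    simp only [Nat.cast_zero, zero_mul, add_zero, zero_add, Function.iterate_zero, id_eq]
    refine ⟨fun h => ?_, fun h => ?_⟩
    · refine (hF' c (by omega)).trans ?_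
      exact Finset.single_le_sum (f := fun i => (transfer S π N g)^[i] F c)
        (fun _ _ => zero_le) (Finset.mem_range.2 (Nat.succ_pos n))
    · refine (arrivalSq_le_iterate hN hg0 hg1 hF hr hc).trans ?_
      exact Finset.single_le_sum (f := fun i => (transfer S π N g)^[i] F c)
        (fun _ _ => zero_le) (Finset.mem_range.2 (Nat.lt_succ_of_le h))
  | succ k ih =>
    rw [Function.iterate_succ_apply']
    obtain rfl | ⟨r, rfl, hr1⟩ : r = 1 ∨ ∃ r', r = r' + 1 ∧ 1 ≤ r' := by
      rcases r with _ | _ | r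
      · omega
      · exact Or.inl rfl
      · exact Or.inr ⟨r + 1, rfl, by omega⟩
    · refine ⟨fun h => by omega, fun _ => ?_⟩
      refine le_trans ?_ (le_transfer_of_newPacket hN hg0 hg1 L 1 (k * noiseGain N L) ?_ hc)
      · push_cast
        ring_nf
        rfl
      · intro x d
        have ih' := @ih (newPacket S π x d) (π d) (π d).pos (by simp [newPacket])
        rw [one_mul]
        rcases lt_or_ge (k + n) (π d : ℕ) with h | h
        · exact ih'.1 h
        · refine le_trans ?_ (ih'.2 h)
          gcongr
          exact hnew x d
    · rw [transfer_of_not_arrives hg0 hg1 _ (not_arrives_of_used_add hc hr1)]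
      refine ⟨fun h => ?_, fun h => ?_⟩
      · refine le_trans ?_ (lintegral_mono fun w => (@ih _ r hr1 (by simp only; omega)).1 (by omega))
        simp only
        rw [lintegral_add_right _ measurable_const, lintegral_normSq_step hN]
        simp only [lintegral_const, measure_univ, mul_one]
        rw [add_assoc]
        refine add_le_add ?_ ?_
        · simpa using normSq_le_pow hg1 hL 1 c.x
        · push_cast
          ring_nf
          rfl
      · refine le_trans ?_ (lintegral_mono fun w => (@ih _ r hr1 (by simp only; omega)).2 (by omega))
        rw [lintegral_add_right _ measurable_const, lintegral_arrivalSq hN hg0 hg1]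
        simp only [lintegral_const, measure_univ, mul_one]
        rw [add_assoc]
        refine add_le_add le_rfl ?_
        have h := noiseGain_le_pow (N := N) hg1 hL r
        calc ((k + 1 : ℕ) : ℝ≥0∞) * noiseGain N L = noiseGain N L + k * noiseGain N L := by
              push_cast
              ring
          _ ≤ _ := by gcongr

/-- With a probability bounded below no input is applied during a window of `n` slots, unless a
long packet is about to arrive. -/
theorem pow_mul_normSq_le_iterate (hN : IsNoise N) (hg : Antitone g) (hg0 : ∀ l, 0 ≤ g l)
    (hg1 : ∀ l, g l ≤ 1) (M : Matrix ι (Fin n) ℝ) {j : ℕ} (hj : j ≤ n) {c : Config n m} {r : ℕ}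
    (hr : 1 ≤ r) (hc : c.used + r = c.len) (h : (c.len : ℕ) ≤ n ∨ j < r) :
    ENNReal.ofReal (g n.succPNat) ^ j * normSq (M *ᵥ (S.A ^ j *ᵥ c.x)) ≤
      (transfer S π N g)^[j] (fun c => normSq (M *ᵥ c.x)) c := by
  induction j generalizing c r with
  | zero => simp
  | succ j ih =>
    have hδ : ENNReal.ofReal (g n.succPNat) ≤ 1 := ENNReal.ofReal_le_one.2 (hg1 _)
    rw [Function.iterate_succ_apply']
    obtain rfl | ⟨r, rfl, hr1⟩ : r = 1 ∨ ∃ r', r = r' + 1 ∧ 1 ≤ r' := by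
      rcases r with _ | _ | r
      · omega
      · exact Or.inl rfl
      · exact Or.inr ⟨r + 1, rfl, by omega⟩
    · have hlen : (c.len : ℕ) ≤ n := by omega
      refine le_trans ?_ (le_transfer_of_newPacket hN hg0 hg1 (M * S.A ^ j)
        (ENNReal.ofReal (g n.succPNat) ^ j) 0 ?_ hc)
      · rw [add_zero, pow_succ, mul_assoc]
        refine mul_le_mul_right ?_ _
        refine le_trans ?_ le_self_add
        refine le_trans ?_ (le_self_add)
        rw [pow_one, ← Matrix.mulVec_mulVec, Matrix.mulVec_mulVec _ (S.A ^ j), ← pow_succ]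
        gcongr
        apply hg
        rw [← PNat.coe_le_coe]
        simp
        omega
      · intro x d
        rw [add_zero, ← Matrix.mulVec_mulVec]
        exact @ih (by omega) (newPacket S π x d) (π d) (π d).pos (by simp [newPacket])
          (by simp only [newPacket]; omega)
    · rw [transfer_of_not_arrives hg0 hg1 _ (not_arrives_of_used_add hc hr1)]
      refine le_trans ?_ (lintegral_mono fun w => @ih (by omega) _ r hr1 (by simp only; omega)
        (by simp only; omega))
      simp only [mulVec_pow_step]
      have hm (y : ι → ℝ) : Measurable fun w : Fin n → ℝ => normSq (y + (M * S.A ^ j) *ᵥ w) :=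
        measurable_normSq.comp ((measurable_mulVec _).const_add y)
      rw [lintegral_const_mul _ (hm _), hN.lintegral_normSq_add]
      refine mul_le_mul' ?_ le_self_add
      exact pow_le_pow_right_of_le_one' hδ (Nat.le_succ j)

end growth

/-! ### Divergence of averages -/

theorem limsup_average_eq_top {a : ℕ → ℝ≥0∞} {η C : ℝ≥0∞} (hη : η ≠ 0) (hC : C ≠ ∞) (p : ℕ)
    (h : ∀ k : ℕ, k * η ≤
      C * ∑ i ∈ Finset.range (p + 1), ∑ j ∈ Finset.range (p + 1), a (k + i + j)) :
    limsup (fun T : ℕ => (∑ t ∈ Finset.range T, a t) / T) atTop = ∞ := by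
  by_contra hlim
  obtain ⟨M, hM1, hM2⟩ := exists_between (lt_top_iff_ne_top.2 hlim)
  obtain ⟨T₀, hT₀⟩ := eventually_atTop.1 (eventually_lt_of_limsup_lt hM1)
  have hsum (T : ℕ) (hT : T₀ ≤ T) (hT1 : 1 ≤ T) : ∑ t ∈ Finset.range T, a t ≤ M * T := by
    have := (hT₀ T hT).le
    rwa [ENNReal.div_le_iff (by simp; omega) (by simp)] at this
  have hsub (K i j : ℕ) (hi : i ∈ Finset.range (p + 1)) (hj : j ∈ Finset.range (p + 1)) :
      ∑ k ∈ Finset.range K, a (K + k + i + j) ≤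
        ∑ t ∈ Finset.range (2 * K + 2 * p), a t := by
    rw [← Finset.sum_image (f := a) (s := Finset.range K) (g := fun k => K + k + i + j)
      (by intro x _ y _ hxy; simp only at hxy; omega)]
    refine Finset.sum_le_sum_of_subset ?_
    intro x hx
    simp only [Finset.mem_image, Finset.mem_range] at hx hi hj ⊢
    omega
  have key (K : ℕ) (hK : T₀ ≤ K) (hK1 : 1 ≤ K) (hKp : p ≤ K) :
      (K : ℝ≥0∞) * η ≤ C * ((p + 1) * (p + 1) * (4 * M)) := by
    have h1 : (K : ℝ≥0∞) * (K * η) ≤ K * (C * ((p + 1) * (p + 1) * (4 * M))) := by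
      calc (K : ℝ≥0∞) * (K * η) = ∑ _k ∈ Finset.range K, (K : ℝ≥0∞) * η := by simp
        _ ≤ ∑ k ∈ Finset.range K, C * ∑ i ∈ Finset.range (p + 1),
              ∑ j ∈ Finset.range (p + 1), a (K + k + i + j) := by
            refine Finset.sum_le_sum fun k _ => ?_
            refine le_trans ?_ (h (K + k))
            gcongr
            omega
        _ = C * ∑ i ∈ Finset.range (p + 1), ∑ j ∈ Finset.range (p + 1),
              ∑ k ∈ Finset.range K, a (K + k + i + j) := by
            rw [← Finset.mul_sum, Finset.sum_comm]
            congr 1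
            refine Finset.sum_congr rfl fun i _ => ?_
            rw [Finset.sum_comm]
        _ ≤ C * ∑ i ∈ Finset.range (p + 1), ∑ j ∈ Finset.range (p + 1), M * (4 * K) := by
            gcongr with i hi j hj
            refine (hsub K i j hi hj).trans ((hsum _ (by omega) (by omega)).trans ?_)
            gcongr
            have : 2 * K + 2 * p ≤ 4 * K := by omega
            exact_mod_cast this
        _ = _ := by
            simp only [Finset.sum_const, Finset.card_range, nsmul_eq_mul]
            push_cast
            ring
    exact (ENNReal.mul_le_mul_iff_right (by simp; omega) (by simp)).1 h1
  have hfin : C * ((p + 1) * (p + 1) * (4 * M)) ≠ ∞ := by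
    refine ENNReal.mul_ne_top hC (ENNReal.mul_ne_top ?_ ?_)
    · exact_mod_cast ENNReal.natCast_ne_top ((p + 1) * (p + 1))
    · exact ENNReal.mul_ne_top (by simp) hM2.ne
  obtain ⟨K, hK⟩ := ENNReal.exists_nat_mul_gt hη hfin
  have h2 := key (K + T₀ + p + 1) (by omega) (by omega) (by omega)
  refine absurd (hK.trans_le (le_trans ?_ h2)) (lt_irrefl _)
  gcongr
  omega

/-! ### Controllability and observability -/

theorem normSq_eq_zero {ι : Type*} [Fintype ι] {y : ι → ℝ} : normSq y = 0 ↔ y = 0 := by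
  rw [normSq, ENNReal.ofReal_eq_zero, ← dotProduct_self_eq_zero]
  exact ⟨fun h => le_antisymm h (dotProduct_self_nonneg_real y), fun h => h.le⟩

/-- The controllability matrix `[S, A S, ..., A ^ n S]`. -/
def ctrlMatrix (A S : Matrix (Fin n) (Fin n) ℝ) : Matrix (Fin n) (Fin (n + 1) × Fin n) ℝ :=
  Matrix.of fun i p => (A ^ (p.1 : ℕ) * S) i p.2

theorem Controllable.surjective {A S : Matrix (Fin n) (Fin n) ℝ} (h : Controllable A S)
    (a : Fin n → ℝ) : ∃ α, ctrlMatrix A S *ᵥ α = a := by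
  have h1 : LinearMap.range (ctrlMatrix A S).mulVecLin = ⊤ := by
    apply Submodule.eq_top_of_finrank_eq
    rw [Module.finrank_fin_fun]
    exact h
  exact LinearMap.range_eq_top.1 h1 a

theorem Controllable.eq_zero {A S : Matrix (Fin n) (Fin n) ℝ} (h : Controllable A S)
    {a : Fin n → ℝ} (ha : ∀ k : ℕ, a ᵥ* (A ^ k * S) = 0) : a = 0 := by
  obtain ⟨α, hα⟩ := h.surjective a
  have h1 : a ᵥ* ctrlMatrix A S = 0 := by
    ext p
    exact congrFun (ha p.1) p.2
  rw [← dotProduct_self_eq_zero]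
  nth_rw 2 [← hα]
  rw [Matrix.dotProduct_mulVec, h1, zero_dotProduct]

theorem normSq_mulVec_le {ι κ : Type*} [Fintype ι] [Fintype κ] (M : Matrix ι κ ℝ) (x : κ → ℝ) :
    normSq (M *ᵥ x) ≤ ENNReal.ofReal (∑ i, ∑ j, M i j ^ 2) * normSq x := by
  have h0 : 0 ≤ ∑ i, ∑ j, M i j ^ 2 := by positivity
  unfold normSq
  rw [← ENNReal.ofReal_mul h0]
  refine ENNReal.ofReal_le_ofReal ?_
  rw [Finset.sum_mul]
  refine Finset.sum_le_sum fun i _ => ?_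
  have h := Finset.sum_mul_sq_le_sq_mul_sq Finset.univ (fun j => M i j) x
  simp only [Matrix.mulVec, dotProduct, ← pow_two]
  exact h

theorem Observable.normSq_le {A S : Matrix (Fin n) (Fin n) ℝ} (h : Observable A S) {ι : Type*}
    [Fintype ι] (L : Matrix ι (Fin n) ℝ) :
    ∃ C : ℝ≥0∞, C ≠ ∞ ∧ ∀ x, normSq (L *ᵥ x) ≤
      C * ∑ j ∈ Finset.range (n + 1), normSq (S *ᵥ (A ^ j *ᵥ x)) := by
  choose α hα using fun i => Controllable.surjective h (L i)
  refine ⟨ENNReal.ofReal (∑ i, ∑ p, Matrix.of α i p ^ 2), ENNReal.ofReal_ne_top, fun x => ?_⟩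
  have h1 : L *ᵥ x = Matrix.of α *ᵥ fun p : Fin (n + 1) × Fin n =>
      (S *ᵥ (A ^ (p.1 : ℕ) *ᵥ x)) p.2 := by
    ext i
    change L i ⬝ᵥ x = α i ⬝ᵥ _
    rw [← hα i, ← Matrix.vecMul_transpose, ← Matrix.dotProduct_mulVec]
    congr 1
    ext p
    rw [Matrix.mulVec_mulVec]
    change _ ⬝ᵥ x = _ ⬝ᵥ x
    congr 1
    ext i
    simp only [ctrlMatrix, Matrix.transpose_apply, Matrix.of_apply]
    rw [← Matrix.transpose_pow, ← Matrix.transpose_mul, Matrix.transpose_apply]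
  rw [h1]
  refine (normSq_mulVec_le _ _).trans (mul_le_mul_right (le_of_eq ?_) _)
  rw [Finset.sum_range fun j => normSq (S *ᵥ (A ^ j *ᵥ x))]
  simp only [normSq]
  rw [← ENNReal.ofReal_sum_of_nonneg fun _ _ => dotProduct_self_nonneg_real _]
  simp only [dotProduct, Fintype.sum_prod_type]

theorem noiseGain_ne_zero {N : Measure (Fin n → ℝ)} (hN : IsNoise N)
    {R A : Matrix (Fin n) (Fin n) ℝ} (hR : R.PosSemidef)
    (hcov : ∀ a : Fin n → ℝ, ∫ w, (a ⬝ᵥ w) * (a ⬝ᵥ w) ∂N = a ⬝ᵥ R *ᵥ a)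
    (hctrl : Controllable A (CFC.sqrt R)) {ι : Type*} [Fintype ι] {L : Matrix ι (Fin n) ℝ}
    {s : ℝ≥0∞} (hL : ∀ x, normSq (L *ᵥ (A *ᵥ x)) = s * normSq (L *ᵥ x)) (hL0 : L ≠ 0) :
    noiseGain N L ≠ 0 := by
  intro h0
  have hsq : CFC.sqrt R * CFC.sqrt R = R := CFC.sqrt_mul_sqrt_self R hR.nonneg
  have hsymm : (CFC.sqrt R)ᵀ = CFC.sqrt R := by
    have h := (Matrix.nonneg_iff_posSemidef.1 (CFC.sqrt_nonneg R)).isHermitian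
    simpa [Matrix.IsHermitian, Matrix.conjTranspose_eq_transpose_of_trivial] using h
  rw [hN.noiseGain_eq, ENNReal.ofReal_eq_zero] at h0
  have h1 : ∑ i, (L i) ⬝ᵥ R *ᵥ (L i) ≤ 0 := by
    refine le_trans (le_of_eq ?_) h0
    have h (i : ι) : Integrable (fun w => (L i ⬝ᵥ w) * (L i ⬝ᵥ w)) N := by
      simpa only [pow_two] using (hN.memLp_dotProduct (L i)).integrable_sq
    simp only [← hcov]
    exact (integral_finsetSum _ fun i _ => h i).symm
  have h2 (i : ι) : (L i) ⬝ᵥ R *ᵥ (L i) =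
      (CFC.sqrt R *ᵥ L i) ⬝ᵥ (CFC.sqrt R *ᵥ L i) := by
    nth_rw 1 [← hsq]
    rw [← Matrix.mulVec_mulVec, Matrix.dotProduct_mulVec, ← Matrix.mulVec_transpose, hsymm]
  simp only [h2] at h1
  have h3 (i : ι) : CFC.sqrt R *ᵥ L i = 0 := by
    have h4 := (Finset.sum_eq_zero_iff_of_nonneg
      (fun i _ => dotProduct_self_nonneg_real (CFC.sqrt R *ᵥ L i))).1
      (le_antisymm h1 (Finset.sum_nonneg fun i _ => dotProduct_self_nonneg_real _)) i
      (Finset.mem_univ i)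
    exact dotProduct_self_eq_zero.1 h4
  have h5 (k : ℕ) (z : Fin n → ℝ) : L *ᵥ (A ^ k *ᵥ (CFC.sqrt R *ᵥ z)) = 0 := by
    induction k with
    | zero =>
      ext i
      change (L i) ⬝ᵥ _ = 0
      rw [pow_zero, Matrix.one_mulVec, Matrix.dotProduct_mulVec, ← Matrix.mulVec_transpose, hsymm,
        h3, zero_dotProduct]
    | succ k ih =>
      rw [← normSq_eq_zero, pow_succ', ← Matrix.mulVec_mulVec, hL, ih]
      simp [normSq]
  refine hL0 ?_
  refine funext fun i => hctrl.eq_zero fun k => ?_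
  rw [← dotProduct_self_eq_zero, ← Matrix.dotProduct_mulVec]
  have h6 := congrFun (h5 k (L i ᵥ* (A ^ k * CFC.sqrt R))) i
  rw [Matrix.mulVec_mulVec _ (A ^ k)] at h6
  exact h6

/-! ### The spectral radius -/

attribute [local instance] Matrix.linftyOpNormedRing Matrix.linftyOpNormedAlgebra

theorem spectralRadius_ne_top (A : Matrix (Fin n) (Fin n) ℂ) : spectralRadius ℂ A ≠ ∞ := by
  rcases Nat.eq_zero_or_pos n with rfl | hn
  · simp [spectrum.SpectralRadius.of_subsingleton]
  · have : Nonempty (Fin n) := ⟨⟨0, hn⟩⟩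
    obtain ⟨z, -, hz⟩ := spectrum.exists_nnnorm_eq_spectralRadius A
    rw [← hz]
    exact ENNReal.coe_ne_top

theorem exists_eigenform (hn : n ≠ 0) (A : Matrix (Fin n) (Fin n) ℝ) :
    ∃ L : Matrix (Fin 2) (Fin n) ℝ, L ≠ 0 ∧
      ∀ x, normSq (L *ᵥ (A *ᵥ x)) = ENNReal.ofReal (rho A ^ 2) * normSq (L *ᵥ x) := by
  have : Nonempty (Fin n) := ⟨⟨0, Nat.pos_of_ne_zero hn⟩⟩
  obtain ⟨z, hz, hzρ⟩ := spectrum.exists_nnnorm_eq_spectralRadius (A.map Complex.ofReal)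
  have hρ : rho A = ‖z‖ := by
    rw [rho, ← hzρ]
    rfl
  rw [spectrum.mem_iff, Matrix.isUnit_iff_isUnit_det, isUnit_iff_ne_zero, not_not] at hz
  obtain ⟨v, hv0, hv⟩ := Matrix.exists_vecMul_eq_zero_iff.2 hz
  have hvA : v ᵥ* (A.map Complex.ofReal) = z • v := by
    rw [Matrix.vecMul_sub, sub_eq_zero, Algebra.algebraMap_eq_smul_one, Matrix.vecMul_smul,
      Matrix.vecMul_one] at hv
    exact hv.symm
  let L : Matrix (Fin 2) (Fin n) ℝ := Matrix.of ![fun i => (v i).re, fun i => (v i).im]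
  have hLx (x : Fin n → ℝ) :
      normSq (L *ᵥ x) = ENNReal.ofReal (‖v ⬝ᵥ fun i => (x i : ℂ)‖ ^ 2) := by
    rw [normSq, ← Complex.normSq_eq_norm_sq, Complex.normSq_apply]
    congr 1
    simp [L, Matrix.mulVec, dotProduct, Fin.sum_univ_two]
  refine ⟨L, fun h => hv0 ?_, fun x => ?_⟩
  · ext i
    apply Complex.ext
    · exact congrFun (congrFun h 0) i
    · exact congrFun (congrFun h 1) i
  · have h1 : (fun i => ((A *ᵥ x) i : ℂ)) = A.map Complex.ofReal *ᵥ fun i => (x i : ℂ) := by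
      ext i
      simp [Matrix.mulVec, dotProduct]
    rw [hLx, hLx, h1, Matrix.dotProduct_mulVec, hvA, smul_dotProduct, norm_smul, mul_pow,
      ENNReal.ofReal_mul (by positivity), hρ]

theorem norm_pow_le_of_spectralRadius_lt (A : Matrix (Fin n) (Fin n) ℂ) {r : ℝ}
    (hr : (spectralRadius ℂ A).toReal < r) : ∃ M : ℝ, 0 ≤ M ∧ ∀ k : ℕ, ‖A ^ k‖ ≤ M * r ^ k := by
  have hr0 : 0 < r := ENNReal.toReal_nonneg.trans_lt hr
  have hlt : spectralRadius ℂ A < ENNReal.ofReal r :=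
    (ENNReal.lt_ofReal_iff_toReal_lt (spectralRadius_ne_top A)).2 hr
  obtain ⟨k₀, hk₀⟩ := eventually_atTop.1
    ((spectrum.pow_nnnorm_pow_one_div_tendsto_nhds_spectralRadius A).eventually_lt_const hlt)
  have h1 (k : ℕ) (hk : k₀ ≤ k) (hk1 : 1 ≤ k) : ‖A ^ k‖ ≤ r ^ k := by
    have h2 := (hk₀ k hk).le
    rw [one_div, ENNReal.rpow_inv_le_iff (by positivity), ENNReal.rpow_natCast,
      ← ENNReal.ofReal_pow hr0.le] at h2
    rw [← ENNReal.ofReal_le_ofReal_iff (by positivity), ofReal_norm]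
    exact h2
  refine ⟨1 + ∑ k ∈ Finset.range (k₀ + 1), ‖A ^ k‖ / r ^ k, by positivity, fun k => ?_⟩
  rcases le_or_gt (k₀ + 1) k with hk | hk
  · refine (h1 k (by omega) (by omega)).trans (le_mul_of_one_le_left (by positivity) ?_)
    have : 0 ≤ ∑ k ∈ Finset.range (k₀ + 1), ‖A ^ k‖ / r ^ k := by positivity
    linarith
  · rw [← div_le_iff₀ (by positivity)]
    have := Finset.single_le_sum (f := fun k => ‖A ^ k‖ / r ^ k) (fun _ _ => by positivity)
      (Finset.mem_range.2 hk)
    linarith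

theorem normSq_pow_le (A : Matrix (Fin n) (Fin n) ℝ) {r : ℝ} (hr : rho A < r) {ι : Type*}
    [Fintype ι] (L : Matrix ι (Fin n) ℝ) :
    ∃ C : ℝ, 0 ≤ C ∧ ∀ (k : ℕ) (x : Fin n → ℝ),
      normSq (L *ᵥ (A ^ k *ᵥ x)) ≤ ENNReal.ofReal (C * r ^ (2 * k)) * normSq x := by
  obtain ⟨M, hM0, hM⟩ := norm_pow_le_of_spectralRadius_lt (A.map Complex.ofReal) hr
  have hentry (k : ℕ) (i j : Fin n) : |(A ^ k) i j| ≤ M * r ^ k := by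
    refine le_trans ?_ (hM k)
    have h1 : (A.map Complex.ofReal) ^ k = (A ^ k).map Complex.ofReal :=
      (Matrix.map_pow A Complex.ofRealHom k).symm
    rw [h1]
    have h2 : ‖((A ^ k).map Complex.ofReal) i j‖₊ ≤ ‖(A ^ k).map Complex.ofReal‖₊ := by
      rw [Matrix.linfty_opNNNorm_def]
      refine le_trans ?_ (Finset.le_sup (Finset.mem_univ i))
      exact Finset.single_le_sum (f := fun j => ‖((A ^ k).map Complex.ofReal) i j‖₊)
        (fun _ _ => zero_le) (Finset.mem_univ j)
    have h3 : ‖((A ^ k).map Complex.ofReal) i j‖ = |(A ^ k) i j| := by simp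
    rw [← h3]
    exact_mod_cast h2
  refine ⟨(∑ i, ∑ j, L i j ^ 2) * (n * n * M ^ 2), by positivity, fun k x => ?_⟩
  refine (normSq_mulVec_le L _).trans ?_
  refine (mul_le_mul_right (normSq_mulVec_le (A ^ k) x) _).trans ?_
  rw [← mul_assoc, ← ENNReal.ofReal_mul (by positivity)]
  refine mul_le_mul_left (ENNReal.ofReal_le_ofReal ?_) _
  rw [mul_assoc]
  refine mul_le_mul_of_nonneg_left ?_ (by positivity)
  calc ∑ i, ∑ j, (A ^ k) i j ^ 2 ≤ ∑ _i : Fin n, ∑ _j : Fin n, (M * r ^ k) ^ 2 := by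
        refine Finset.sum_le_sum fun i _ => Finset.sum_le_sum fun j _ => ?_
        rw [← sq_abs]
        exact pow_le_pow_left₀ (abs_nonneg _) (hentry k i j) 2
    _ = _ := by
        simp
        ring

/-! ### Gaussian disturbances -/

theorem memLp_gaussian_ofLp (R : Matrix (Fin n) (Fin n) ℝ) (a : Fin n → ℝ) :
    MemLp (fun z : EuclideanSpace ℝ (Fin n) => a ⬝ᵥ z.ofLp) 2 (multivariateGaussian 0 R) := by
  have h : (fun z : EuclideanSpace ℝ (Fin n) => a ⬝ᵥ z.ofLp) =
      (innerSL ℝ (WithLp.toLp 2 a) : EuclideanSpace ℝ (Fin n) →L[ℝ] ℝ) ∘ id := by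
    ext z
    simp [EuclideanSpace.inner_eq_star_dotProduct, dotProduct_comm]
  rw [h]
  exact IsGaussian.memLp_two_id.continuousLinearMap_comp _

theorem integral_gaussian_ofLp (R : Matrix (Fin n) (Fin n) ℝ) (a : Fin n → ℝ) :
    ∫ z : EuclideanSpace ℝ (Fin n), a ⬝ᵥ z.ofLp ∂(multivariateGaussian 0 R) = 0 := by
  have h := ContinuousLinearMap.integral_comp_comm (innerSL ℝ (WithLp.toLp 2 a))
    (IsGaussian.integrable_fun_id (μ := multivariateGaussian (0 : EuclideanSpace ℝ (Fin n)) R))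
  rw [integral_id_multivariateGaussian, map_zero] at h
  rw [← h]
  simp [EuclideanSpace.inner_eq_star_dotProduct, dotProduct_comm]

theorem measurable_ofLp_gaussian : Measurable fun z : EuclideanSpace ℝ (Fin n) => z.ofLp := by
  fun_prop

theorem isNoise_gaussian (R : Matrix (Fin n) (Fin n) ℝ) :
    IsNoise ((multivariateGaussian (0 : EuclideanSpace ℝ (Fin n)) R).map fun z => z.ofLp) where
  prob := Measure.isProbabilityMeasure_map measurable_ofLp_gaussian.aemeasurable
  memLp i := by
    rw [memLp_map_measure_iff (measurable_pi_apply i).aestronglyMeasurable measurable_ofLp_gaussian.aemeasurable]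
    simpa [Function.comp_def] using memLp_gaussian_ofLp R (Pi.single i 1)
  mean i := by
    rw [integral_map measurable_ofLp_gaussian.aemeasurable
      (measurable_pi_apply i).aestronglyMeasurable]
    simpa using integral_gaussian_ofLp R (Pi.single i 1)

theorem integral_sq_gaussian {R : Matrix (Fin n) (Fin n) ℝ} (hR : R.PosSemidef) (a : Fin n → ℝ) :
    ∫ w, (a ⬝ᵥ w) * (a ⬝ᵥ w)
      ∂((multivariateGaussian (0 : EuclideanSpace ℝ (Fin n)) R).map fun z => z.ofLp) =
    a ⬝ᵥ R *ᵥ a := by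
  have hm : Measurable fun w : Fin n → ℝ => (a ⬝ᵥ w) * (a ⬝ᵥ w) := by
    unfold dotProduct
    fun_prop
  rw [integral_map measurable_ofLp_gaussian.aemeasurable hm.aestronglyMeasurable]
  have h := covarianceBilin_multivariateGaussian (μ := 0) hR (WithLp.toLp 2 a) (WithLp.toLp 2 a)
  rw [covarianceBilin_apply IsGaussian.memLp_two_id] at h
  rw [← h]
  refine integral_congr_ae (Eventually.of_forall fun z => ?_)
  simp [EuclideanSpace.inner_eq_star_dotProduct, dotProduct_comm]

theorem map_eq_of_hasLaw {Ω : Type*} [MeasurableSpace Ω] {P : Measure Ω}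
    {R : Matrix (Fin n) (Fin n) ℝ} {w : Ω → Fin n → ℝ} (hw : Measurable w)
    (h : HasLaw (fun ω => WithLp.toLp 2 (w ω)) (multivariateGaussian 0 R) P) :
    P.map w = (multivariateGaussian (0 : EuclideanSpace ℝ (Fin n)) R).map fun z => z.ofLp := by
  rw [← h.map_eq, Measure.map_map measurable_ofLp_gaussian (by fun_prop)]
  rfl

theorem ofReal_quadratic {Q : Matrix (Fin n) (Fin n) ℝ} (hQ : Q.PosSemidef) (x : Fin n → ℝ) :
    ENNReal.ofReal (x ⬝ᵥ Q *ᵥ x) = normSq (CFC.sqrt Q *ᵥ x) := by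
  have hsq : CFC.sqrt Q * CFC.sqrt Q = Q := CFC.sqrt_mul_sqrt_self Q hQ.nonneg
  have hsymm : (CFC.sqrt Q)ᵀ = CFC.sqrt Q := by
    have h := (Matrix.nonneg_iff_posSemidef.1 (CFC.sqrt_nonneg Q)).isHermitian
    simpa [Matrix.IsHermitian, Matrix.conjTranspose_eq_transpose_of_trivial] using h
  rw [normSq]
  nth_rw 1 [← hsq]
  rw [← Matrix.mulVec_mulVec, Matrix.dotProduct_mulVec, ← Matrix.mulVec_transpose, hsymm]

/-! ### The condition is necessary -/

theorem rho_nonneg (A : Matrix (Fin n) (Fin n) ℝ) : 0 ≤ rho A := ENNReal.toReal_nonneg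

theorem rho_of_dim_zero (A : Matrix (Fin 0) (Fin 0) ℝ) : rho A = 0 := by
  simp [rho, spectrum.SpectralRadius.of_subsingleton]

section necessity

variable {Ω : Type*} [MeasurableSpace Ω] {P : Measure Ω} [IsProbabilityMeasure P]
  {x₀ : Ω → Fin n → ℝ} {w : ℕ → Ω → Fin n → ℝ} {e : ℕ → Ω → ℕ+ → Bool}

theorem limsup_avgCost_eq_top (S : Loop n m) (π : Policy) (d₀ : ℕ+)
    {R Q : Matrix (Fin n) (Fin n) ℝ} (hR : R.PosSemidef) (hQ : Q.PosSemidef)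
    (hctrl : Controllable S.A (CFC.sqrt R)) (hobs : Observable S.A (CFC.sqrt Q))
    {g : ℕ+ → ℝ} (hg : Antitone g) (hg0 : ∀ l, 0 ≤ g l) (hg1 : ∀ l, g l ≤ 1)
    {N : Measure (Fin n → ℝ)} (hN : IsNoise N)
    (hcov : ∀ a : Fin n → ℝ, ∫ w, (a ⬝ᵥ w) * (a ⬝ᵥ w) ∂N = a ⬝ᵥ R *ᵥ a)
    (htraj : ∀ (t : ℕ) {F : Config n m → ℝ≥0∞}, Measurable F →
      ∫⁻ ω, F (trajectory S π (x₀ ω) d₀ (fun s => w s ω) (fun s => e s ω) t) ∂P =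
        ∫⁻ ω, (transfer S π N g)^[t] F (newPacket S π (x₀ ω) d₀) ∂P)
    (htm : ∀ t, Measurable fun ω =>
      trajectory S π (x₀ ω) d₀ (fun s => w s ω) (fun s => e s ω) t)
    (hge : ∀ l : ℕ+, 1 ≤ g l * rho S.A ^ (2 * (l : ℕ))) :
    limsup (avgCost P S Q x₀ d₀ w e π) atTop = ∞ := by
  have := hN.prob
  have hn : n ≠ 0 := by
    rintro rfl
    have := hge 1
    simp [rho_of_dim_zero] at this
    linarith
  obtain ⟨L, hL0, hLA⟩ := exists_eigenform hn S.A
  have hpow (k : ℕ) (x : Fin n → ℝ) :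
      normSq (L *ᵥ (S.A ^ k *ᵥ x)) = ENNReal.ofReal (rho S.A ^ (2 * k)) * normSq (L *ᵥ x) := by
    induction k with
    | zero => simp
    | succ k ih =>
      rw [pow_succ', ← Matrix.mulVec_mulVec, hLA, ih, ← mul_assoc,
        ← ENNReal.ofReal_mul (by positivity), mul_add, pow_add, mul_one, mul_comm (rho S.A ^ 2)]
  have hL (l : ℕ+) (x : Fin n → ℝ) : normSq (L *ᵥ x) ≤
      ENNReal.ofReal (g l) * normSq (L *ᵥ (S.A ^ (l : ℕ) *ᵥ x)) := by
    rw [hpow, ← mul_assoc, ← ENNReal.ofReal_mul (hg0 l)]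
    exact le_mul_of_one_le_left' (ENNReal.one_le_ofReal.2 (hge l))
  have hκ := noiseGain_ne_zero hN hR hcov hctrl hLA hL0
  obtain ⟨C, hC, hCx⟩ := hobs.normSq_le L
  set δ := ENNReal.ofReal (g n.succPNat) with hδ
  have hδ0 : δ ≠ 0 := by
    have h := hge n.succPNat
    have : g n.succPNat ≠ 0 := fun h0 => by
      rw [h0] at h
      linarith
    rw [hδ]
    simpa using lt_of_le_of_ne (hg0 _) this.symm
  have hδ1 : δ ≤ 1 := ENNReal.ofReal_le_one.2 (hg1 _)
  classical
  let F : Config n m → ℝ≥0∞ := fun c =>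
    if (c.len : ℕ) ≤ n ∨ c.used + n < c.len then normSq (L *ᵥ c.x) else 0
  have hLm : Measurable fun c : Config n m => normSq (L *ᵥ c.x) :=
    measurable_normSq.comp ((measurable_mulVec L).comp Config.measurable_x)
  have hFm : Measurable F := by
    refine Measurable.ite ?_ hLm measurable_const
    have h : Measurable fun c : Config n m => (c.used, c.len) := by fun_prop
    exact h (MeasurableSet.of_discrete
      (s := {p : ℕ × ℕ+ | (p.2 : ℕ) ≤ n ∨ p.1 + n < p.2}))
  let f : Config n m → ℝ≥0∞ := fun c => normSq (CFC.sqrt Q *ᵥ c.x)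
  have hfm : Measurable f :=
    measurable_normSq.comp ((measurable_mulVec _).comp Config.measurable_x)
  have hF1 (x : Fin n → ℝ) (d : ℕ+) : normSq (L *ᵥ x) ≤ F (newPacket S π x d) := by
    have h : (π d : ℕ) ≤ n ∨ 0 + n < (π d : ℕ) := by omega
    simp only [F, newPacket, if_pos h]
    exact le_rfl
  have hF2 (c : Config n m) (h : c.used + n < c.len) : normSq (L *ᵥ c.x) ≤ F c := by
    simp only [F, if_pos (Or.inr h : (c.len : ℕ) ≤ n ∨ c.used + n < c.len)]
    exact le_rfl
  let T := transfer S π N g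
  have hTm {G : Config n m → ℝ≥0∞} (hG : Measurable G) (i : ℕ) : Measurable (T^[i] G) :=
    measurable_transfer_iterate S π N g hG i
  let c : ℕ → Ω → Config n m := fun t ω =>
    trajectory S π (x₀ ω) d₀ (fun s => w s ω) (fun s => e s ω) t
  have hshift {G : Config n m → ℝ≥0∞} (hG : Measurable G) (t i : ℕ) :
      ∫⁻ ω, T^[i] G (c t ω) ∂P = ∫⁻ ω, G (c (t + i) ω) ∂P := by
    rw [htraj t (hTm hG i), htraj (t + i) hG, Function.iterate_add_apply]
  have hsum {G : Config n m → ℝ≥0∞} (hG : Measurable G) (t : ℕ) :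
      ∫⁻ ω, ∑ i ∈ Finset.range (n + 1), T^[i] G (c t ω) ∂P =
        ∑ i ∈ Finset.range (n + 1), ∫⁻ ω, G (c (t + i) ω) ∂P := by
    rw [lintegral_finsetSum _ fun i _ =>
      show Measurable fun ω => T^[i] G (c t ω) from (hTm hG i).comp (htm t)]
    exact Finset.sum_congr rfl fun i _ => hshift hG t i
  have hcost : slotCost P S Q x₀ d₀ w e π = fun t => ∫⁻ ω, f (c t ω) ∂P := by
    funext t
    exact lintegral_congr fun ω => ofReal_quadratic hQ _
  have hgrow (k : ℕ) : (k : ℝ≥0∞) * noiseGain N L ≤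
      ∑ i ∈ Finset.range (n + 1), ∫⁻ ω, F (c (k + i) ω) ∂P := by
    rw [← hsum hFm, htraj k (F := fun c => ∑ i ∈ Finset.range (n + 1), T^[i] F c)
      (Finset.measurable_sum _ fun i _ => hTm hFm i)]
    calc (k : ℝ≥0∞) * noiseGain N L = ∫⁻ _ω, (k : ℝ≥0∞) * noiseGain N L ∂P := by simp
      _ ≤ _ := by
        refine lintegral_mono fun ω => ?_
        have h := add_mul_noiseGain_le_iterate (π := π) hN hg0 hg1 hL hF1 hF2 k
          (c := newPacket S π (x₀ ω) d₀) (π d₀).pos (by simp [newPacket])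
        rcases lt_or_ge (k + n) (π d₀ : ℕ) with hk | hk
        · exact le_add_self.trans (h.1 hk)
        · exact le_add_self.trans (h.2 hk)
  have hwin (t : ℕ) : δ ^ n * ∫⁻ ω, F (c t ω) ∂P ≤
      C * ∑ j ∈ Finset.range (n + 1), ∫⁻ ω, f (c (t + j) ω) ∂P := by
    rw [← hsum hfm, ← lintegral_const_mul' _ _ hC,
      ← lintegral_const_mul' _ _ (ENNReal.pow_ne_top ENNReal.ofReal_ne_top)]
    refine lintegral_mono fun ω => ?_
    have hused : (c t ω).used < (c t ω).len := used_lt_len_trajectory S π _ _ _ _ t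
    generalize c t ω = c' at hused
    by_cases h : (c'.len : ℕ) ≤ n ∨ c'.used + n < c'.len
    · calc δ ^ n * F c' = δ ^ n * normSq (L *ᵥ c'.x) := by simp only [F, if_pos h]
        _ ≤ δ ^ n * (C * ∑ j ∈ Finset.range (n + 1),
              normSq (CFC.sqrt Q *ᵥ (S.A ^ j *ᵥ c'.x))) := by
            gcongr
            exact hCx _
        _ = C * ∑ j ∈ Finset.range (n + 1),
              δ ^ n * normSq (CFC.sqrt Q *ᵥ (S.A ^ j *ᵥ c'.x)) := by
            rw [← Finset.mul_sum]
            ring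
        _ ≤ C * ∑ j ∈ Finset.range (n + 1), T^[j] f c' := by
            gcongr with j hj
            have hj' : j ≤ n := Nat.lt_succ_iff.1 (Finset.mem_range.1 hj)
            refine le_trans ?_ (pow_mul_normSq_le_iterate hN hg hg0 hg1 (CFC.sqrt Q) hj'
              (c := c') (r := c'.len - c'.used) (by omega) (by omega) (by omega))
            refine mul_le_mul_left ?_ _
            exact pow_le_pow_right_of_le_one' hδ1 hj'
    · simp only [F, if_neg h, mul_zero]
      exact zero_le
  unfold avgCost
  rw [hcost]
  refine limsup_average_eq_top (η := δ ^ n * noiseGain N L) (C := C)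
    (mul_ne_zero (pow_ne_zero _ hδ0) hκ) hC n fun k => ?_
  calc (k : ℝ≥0∞) * (δ ^ n * noiseGain N L) = δ ^ n * (k * noiseGain N L) := by ring
    _ ≤ δ ^ n * ∑ i ∈ Finset.range (n + 1), ∫⁻ ω, F (c (k + i) ω) ∂P := by
        gcongr
        exact hgrow k
    _ = ∑ i ∈ Finset.range (n + 1), δ ^ n * ∫⁻ ω, F (c (k + i) ω) ∂P := Finset.mul_sum _ _ _
    _ ≤ ∑ i ∈ Finset.range (n + 1),
          C * ∑ j ∈ Finset.range (n + 1), ∫⁻ ω, f (c (k + i + j) ω) ∂P :=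
        Finset.sum_le_sum fun i _ => hwin (k + i)
    _ = _ := (Finset.mul_sum _ _ _).symm

end necessity

/-! ### Averages of asymptotically periodic sequences -/

theorem tendsto_cesaro_of_periodic {D : ℕ → ℝ} {l : ℕ} (hl : 0 < l) :
    Tendsto (fun T : ℕ => (T : ℝ)⁻¹ * ∑ t ∈ Finset.range T, D (t % l)) atTop
      (𝓝 ((∑ j ∈ Finset.range l, D j) / l)) := by
  set μ := (∑ j ∈ Finset.range l, D j) / l with hμ
  let W : ℕ → ℝ := fun T => ∑ t ∈ Finset.range T, (D (t % l) - μ)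
  have hper : Function.Periodic W l := by
    intro T
    simp only [W]
    rw [add_comm T l, Finset.sum_range_add]
    have h1 : ∑ t ∈ Finset.range l, (D (t % l) - μ) = 0 := by
      rw [Finset.sum_sub_distrib, Finset.sum_congr rfl fun t ht => by
        rw [Nat.mod_eq_of_lt (Finset.mem_range.1 ht)]]
      simp only [Finset.sum_const, Finset.card_range, nsmul_eq_mul, hμ]
      field_simp
      ring
    rw [h1, zero_add]
    simp
  have hbd (T : ℕ) : |W T| ≤ ∑ r ∈ Finset.range l, |W r| := by
    rw [← hper.map_mod_nat T]
    exact Finset.single_le_sum (f := fun r => |W r|) (fun _ _ => abs_nonneg _)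
      (Finset.mem_range.2 (Nat.mod_lt _ hl))
  have h0 : Tendsto (fun T : ℕ => (T : ℝ)⁻¹ * W T) atTop (𝓝 0) := by
    refine squeeze_zero_norm (a := fun T : ℕ => (T : ℝ)⁻¹ * ∑ r ∈ Finset.range l, |W r|)
      (fun T => ?_) ?_
    · rw [norm_mul, Real.norm_eq_abs, Real.norm_eq_abs, abs_of_nonneg (by positivity)]
      exact mul_le_mul_of_nonneg_left (hbd T) (by positivity)
    · simpa using (tendsto_inv_atTop_nhds_zero_nat (𝕜 := ℝ)).mul_const (∑ r ∈ Finset.range l, |W r|)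
  have h1 := h0.add_const μ
  rw [zero_add] at h1
  refine h1.congr' ?_
  filter_upwards [eventually_gt_atTop 0] with T hT
  have : (T : ℝ) ≠ 0 := by positivity
  simp only [W, Finset.sum_sub_distrib, Finset.sum_const, Finset.card_range, nsmul_eq_mul]
  field_simp
  ring

theorem tendsto_cesaro_of_residues {u D : ℕ → ℝ} {l : ℕ} (hl : 0 < l)
    (h : ∀ j < l, Tendsto (fun s => u (l * s + j)) atTop (𝓝 (D j))) :
    Tendsto (fun T : ℕ => (T : ℝ)⁻¹ * ∑ t ∈ Finset.range T, u t) atTop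
      (𝓝 ((∑ j ∈ Finset.range l, D j) / l)) := by
  have h0 : Tendsto (fun t => u t - D (t % l)) atTop (𝓝 0) := by
    rw [Metric.tendsto_atTop']
    intro ε hε
    have h1 : ∀ᶠ s in atTop, ∀ j ∈ Finset.range l, dist (u (l * s + j)) (D j) < ε :=
      (eventually_all_finset _).2 fun j hj =>
        (h j (Finset.mem_range.1 hj)).eventually (Metric.ball_mem_nhds _ hε)
    obtain ⟨s₀, hs₀⟩ := eventually_atTop.1 h1
    refine ⟨l * s₀, fun t ht => ?_⟩
    have h2 := hs₀ (t / l) ((Nat.le_div_iff_mul_le hl).2 (by rw [mul_comm]; exact ht.le)) (t % l)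
      (Finset.mem_range.2 (Nat.mod_lt _ hl))
    rw [Nat.div_add_mod] at h2
    simpa [Real.dist_eq] using h2
  have h3 := h0.cesaro.add (tendsto_cesaro_of_periodic (D := D) hl)
  rw [zero_add] at h3
  refine h3.congr fun T => ?_
  rw [Finset.sum_sub_distrib]
  ring

theorem exists_tendsto_average {a : ℕ → ℝ≥0∞} {l : ℕ} (hl : 0 < l) (ha : ∀ t, a t ≠ ∞)
    {D : ℕ → ℝ≥0∞} (hD : ∀ j < l, D j ≠ ∞)
    (h : ∀ j < l, Tendsto (fun s => a (l * s + j)) atTop (𝓝 (D j))) :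
    ∃ J : ℝ≥0, Tendsto (fun T : ℕ => (∑ t ∈ Finset.range T, a t) / T) atTop (𝓝 (J : ℝ≥0∞)) := by
  have h1 := tendsto_cesaro_of_residues (u := fun t => (a t).toReal) (D := fun j => (D j).toReal) hl
    fun j hj => (ENNReal.tendsto_toReal (hD j hj)).comp (h j hj)
  refine ⟨_, (ENNReal.tendsto_ofReal h1).congr' ?_⟩
  filter_upwards [eventually_gt_atTop 0] with T hT
  rw [ENNReal.ofReal_mul (by positivity), ENNReal.ofReal_inv_of_pos (by positivity),
    ENNReal.ofReal_natCast, ← ENNReal.toReal_sum fun t _ => ha t, ENNReal.ofReal_toReal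
    (ENNReal.sum_ne_top.2 fun t _ => ha t), ENNReal.div_eq_inv_mul]

/-! ### The condition is sufficient -/

section sufficiency

variable {S : Loop n m} {π : Policy} {N : Measure (Fin n → ℝ)} {g : ℕ+ → ℝ}
  {ι : Type*} [Fintype ι]

theorem iterate_eq_of_newPacket (hN : IsNoise N) (hg0 : ∀ l, 0 ≤ g l) (hg1 : ∀ l, g l ≤ 1)
    (M : Matrix ι (Fin n) ℝ) {a b : ℝ≥0∞} (ha : a ≠ ∞) {F : Config n m → ℝ≥0∞}
    (hF : ∀ x d, F (newPacket S π x d) = a * normSq (M *ᵥ x) + b) {r : ℕ} (hr : 1 ≤ r)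
    {c : Config n m} (hc : c.used + r = c.len) :
    (transfer S π N g)^[r] F c =
      a * (arrivalSq S g M r c + ∑ i ∈ Finset.range r, noiseGain N (M * S.A ^ i)) + b := by
  have := hN.prob
  induction r, hr using Nat.le_induction generalizing c with
  | base => simpa using transfer_eq_of_newPacket hN hg0 hg1 M a b hF hc
  | succ r hr ih =>
    rw [Function.iterate_succ_apply',
      transfer_of_not_arrives hg0 hg1 _ (not_arrives_of_used_add hc hr)]
    have h (w : Fin n → ℝ) := @ih ⟨S.A *ᵥ c.x + w, c.aoi + 1, c.len, c.used + 1, c.payload⟩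
      (by simp only; omega)
    simp only [h]
    rw [lintegral_add_right _ measurable_const, lintegral_const_mul' _ _ ha,
      lintegral_add_right _ measurable_const, lintegral_arrivalSq hN hg0 hg1,
      Finset.sum_range_succ]
    simp only [lintegral_const, measure_univ, mul_one]
    ring

theorem iterate_normSq_of_lt (hN : IsNoise N) (hg0 : ∀ l, 0 ≤ g l) (hg1 : ∀ l, g l ≤ 1)
    (M : Matrix ι (Fin n) ℝ) {k : ℕ} {c : Config n m} (hc : c.used + k < c.len) :
    (transfer S π N g)^[k] (fun c => normSq (M *ᵥ c.x)) c =
      normSq (M *ᵥ (S.A ^ k *ᵥ c.x)) + ∑ i ∈ Finset.range k, noiseGain N (M * S.A ^ i) := by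
  have := hN.prob
  induction k generalizing c with
  | zero => simp
  | succ k ih =>
    rw [Function.iterate_succ_apply', transfer_of_not_arrives hg0 hg1 _ (by
      unfold Config.arrives
      omega)]
    have h (w : Fin n → ℝ) := @ih ⟨S.A *ᵥ c.x + w, c.aoi + 1, c.len, c.used + 1, c.payload⟩
      (by simp only; omega)
    simp only [h, mulVec_pow_step]
    rw [lintegral_add_right _ measurable_const, hN.lintegral_normSq_add, Finset.sum_range_succ]
    simp only [lintegral_const, measure_univ, mul_one]
    ring

/-- The input of a detected packet cancels the predicted state. -/
theorem arrivalSq_newPacket (hK : S.A + S.B * S.K = 0) (M : Matrix ι (Fin n) ℝ) (x : Fin n → ℝ)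
    (d : ℕ+) : arrivalSq S g M (π d) (newPacket S π x d) =
      ENNReal.ofReal (g (π d)) * normSq ((M * S.A ^ (π d : ℕ)) *ᵥ x) := by
  have h : S.A ^ (π d : ℕ) *ᵥ x + S.B *ᵥ (S.K *ᵥ (S.A ^ ((π d : ℕ) - 1) *ᵥ x)) = 0 := by
    have h1 : S.A ^ (π d : ℕ) = S.A * S.A ^ ((π d : ℕ) - 1) := by
      rw [← pow_succ', Nat.sub_add_cancel (π d).pos]
    rw [h1, Matrix.mulVec_mulVec, Matrix.mulVec_mulVec, ← Matrix.add_mulVec,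
      ← Matrix.add_mul, hK]
    simp
  simp only [arrivalSq, newPacket, h]
  simp [normSq]

/-- The noise part of the expected cost in slot `l * s + j` when all packets have length `l`. -/
def noiseCost (N : Measure (Fin n → ℝ)) (A : Matrix (Fin n) (Fin n) ℝ) (G : ℝ≥0∞) (l : ℕ)
    (M : Matrix ι (Fin n) ℝ) (j s : ℕ) : ℝ≥0∞ :=
  ∑ i ∈ Finset.range j, noiseGain N (M * A ^ i) +
    ∑ q ∈ Finset.range s, G ^ q * ∑ i ∈ Finset.range l, noiseGain N (M * A ^ (l * q + j) * A ^ i)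

theorem iterate_normSq_newPacket (hN : IsNoise N) (hg0 : ∀ l, 0 ≤ g l) (hg1 : ∀ l, g l ≤ 1)
    (hK : S.A + S.B * S.K = 0) (M : Matrix ι (Fin n) ℝ) {l : ℕ+} (hπ : ∀ d, π d = l) {j : ℕ}
    (hj : j < l) (s : ℕ) (x : Fin n → ℝ) (d : ℕ+) :
    (transfer S π N g)^[l * s + j] (fun c => normSq (M *ᵥ c.x)) (newPacket S π x d) =
      ENNReal.ofReal (g l) ^ s * normSq ((M * S.A ^ (l * s + j)) *ᵥ x) +
        noiseCost N S.A (ENNReal.ofReal (g l)) l M j s := by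
  induction s generalizing x d with
  | zero =>
    have h := iterate_normSq_of_lt (S := S) (π := π) (c := newPacket S π x d) (k := j) hN hg0 hg1 M
      (by simp only [newPacket, hπ]; omega)
    simp only [mul_zero, zero_add]
    rw [h]
    simp [noiseCost, newPacket]
  | succ s ih =>
    have h := iterate_eq_of_newPacket (S := S) (π := π) hN hg0 hg1 (M * S.A ^ (l * s + j))
      (ENNReal.pow_ne_top ENNReal.ofReal_ne_top) ih (r := π d) (c := newPacket S π x d) (π d).pos
      (by simp [newPacket])
    rw [arrivalSq_newPacket hK, hπ d] at h
    have e : (l : ℕ) * (s + 1) + j = l + (l * s + j) := by ring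
    rw [e, Function.iterate_add_apply, h, noiseCost, noiseCost, Finset.sum_range_succ, pow_succ,
      Matrix.mul_assoc M, ← pow_add, add_comm (l : ℕ) (l * s + j)]
    ring

theorem pow_mul_normSq_le_geometric {A : Matrix (Fin n) (Fin n) ℝ} {M : Matrix ι (Fin n) ℝ} {C r : ℝ}
    (hC : 0 ≤ C) (hr : 0 ≤ r)
    (hM : ∀ (k : ℕ) (x : Fin n → ℝ),
      normSq (M *ᵥ (A ^ k *ᵥ x)) ≤ ENNReal.ofReal (C * r ^ (2 * k)) * normSq x)
    (G : ℝ) (hG : 0 ≤ G) (l q k : ℕ) (x : Fin n → ℝ) :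
    ENNReal.ofReal G ^ q * normSq ((M * A ^ (l * q + k)) *ᵥ x) ≤
      ENNReal.ofReal (G * r ^ (2 * l)) ^ q * (ENNReal.ofReal (C * r ^ (2 * k)) * normSq x) := by
  rw [← Matrix.mulVec_mulVec]
  refine (mul_le_mul_right (hM _ x) _).trans (le_of_eq ?_)
  rw [← mul_assoc, ← mul_assoc, ← ENNReal.ofReal_pow hG, ← ENNReal.ofReal_pow (by positivity),
    ← ENNReal.ofReal_mul (by positivity), ← ENNReal.ofReal_mul (by positivity)]
  congr 2
  rw [mul_pow, ← pow_mul]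
  ring

end sufficiency

theorem lintegral_normSq_ne_top {Ω : Type*} [MeasurableSpace Ω] {P : Measure Ω}
    {x₀ : Ω → Fin n → ℝ} (hx₀2 : MemLp x₀ 2 P) :
    ∫⁻ ω, normSq (x₀ ω) ∂P ≠ ∞ := by
  have h : Integrable (fun ω => x₀ ω ⬝ᵥ x₀ ω) P := by
    refine integrable_finsetSum _ fun i _ => ?_
    have h1 : MemLp (fun ω => x₀ ω i) 2 P := memLp_pi_iff.1 hx₀2 i
    simpa only [pow_two] using h1.integrable_sq
  unfold normSq
  rw [← ofReal_integral_eq_lintegral_ofReal h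
    (Eventually.of_forall fun _ => dotProduct_self_nonneg_real _)]
  exact ENNReal.ofReal_ne_top

section

variable {Ω : Type*} [MeasurableSpace Ω] {P : Measure Ω} [IsProbabilityMeasure P]
  {x₀ : Ω → Fin n → ℝ} {w : ℕ → Ω → Fin n → ℝ} {e : ℕ → Ω → ℕ+ → Bool}

theorem exists_tendsto_avgCost (S : Loop n m) (hK : S.A + S.B * S.K = 0) (d₀ : ℕ+)
    {Q : Matrix (Fin n) (Fin n) ℝ} (hQ : Q.PosSemidef)
    {g : ℕ+ → ℝ} (hg0 : ∀ l, 0 ≤ g l) (hg1 : ∀ l, g l ≤ 1)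
    {N : Measure (Fin n → ℝ)} (hN : IsNoise N) (hx₀2 : MemLp x₀ 2 P)
    {l : ℕ+} (htraj : ∀ (t : ℕ) {F : Config n m → ℝ≥0∞}, Measurable F →
      ∫⁻ ω, F (trajectory S (fun _ => l) (x₀ ω) d₀ (fun s => w s ω) (fun s => e s ω) t) ∂P =
        ∫⁻ ω, (transfer S (fun _ => l) N g)^[t] F (newPacket S (fun _ => l) (x₀ ω) d₀) ∂P)
    (hlt : g l * rho S.A ^ (2 * (l : ℕ)) < 1) :
    ∃ J : ℝ≥0, Tendsto (avgCost P S Q x₀ d₀ w e fun _ => l) atTop (𝓝 (J : ℝ≥0∞)) := by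
  have := hN.prob
  obtain ⟨r, hr, hr1⟩ : ∃ r, rho S.A < r ∧ g l * r ^ (2 * (l : ℕ)) < 1 := by
    have hc : Continuous fun r : ℝ => g l * r ^ (2 * (l : ℕ)) := by fun_prop
    have h1 : ∀ᶠ r in 𝓝[>] (rho S.A), g l * r ^ (2 * (l : ℕ)) < 1 :=
      (hc.continuousAt.eventually_lt_const hlt).filter_mono nhdsWithin_le_nhds
    exact (eventually_mem_nhdsWithin.and h1).exists
  have hr0 : 0 ≤ r := (rho_nonneg _).trans hr.le
  set M := CFC.sqrt Q
  set G := ENNReal.ofReal (g l)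
  set θ := ENNReal.ofReal (g l * r ^ (2 * (l : ℕ))) with hθ
  have hθ1 : θ < 1 := ENNReal.ofReal_lt_one.2 hr1
  obtain ⟨C, hC, hM⟩ := normSq_pow_le S.A hr M
  have hnoise (q k : ℕ) : G ^ q * noiseGain N (M * S.A ^ (l * q + k)) ≤
      θ ^ q * (ENNReal.ofReal (C * r ^ (2 * k)) * noiseGain N (1 : Matrix (Fin n) (Fin n) ℝ)) := by
    unfold noiseGain
    simp only [Matrix.one_mulVec]
    rw [← lintegral_const_mul' _ _ (ENNReal.pow_ne_top ENNReal.ofReal_ne_top),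
      ← lintegral_const_mul' _ _ ENNReal.ofReal_ne_top,
      ← lintegral_const_mul' _ _ (ENNReal.pow_ne_top ENNReal.ofReal_ne_top)]
    exact lintegral_mono fun w => pow_mul_normSq_le_geometric hC hr0 hM (g l) (hg0 l) l q k w
  have hinit (q k : ℕ) : G ^ q * ∫⁻ ω, normSq ((M * S.A ^ (l * q + k)) *ᵥ x₀ ω) ∂P ≤
      θ ^ q * (ENNReal.ofReal (C * r ^ (2 * k)) * ∫⁻ ω, normSq (x₀ ω) ∂P) := by
    rw [← lintegral_const_mul' _ _ (ENNReal.pow_ne_top ENNReal.ofReal_ne_top),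
      ← lintegral_const_mul' _ _ ENNReal.ofReal_ne_top,
      ← lintegral_const_mul' _ _ (ENNReal.pow_ne_top ENNReal.ofReal_ne_top)]
    exact lintegral_mono fun ω => pow_mul_normSq_le_geometric hC hr0 hM (g l) (hg0 l) l q k (x₀ ω)
  have hX (k : ℕ) : ENNReal.ofReal (C * r ^ (2 * k)) * ∫⁻ ω, normSq (x₀ ω) ∂P ≠ ∞ :=
    ENNReal.mul_ne_top ENNReal.ofReal_ne_top (lintegral_normSq_ne_top hx₀2)
  have hcost (s j : ℕ) (hj : j < l) : slotCost P S Q x₀ d₀ w e (fun _ => l) (l * s + j) =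
      G ^ s * ∫⁻ ω, normSq ((M * S.A ^ (l * s + j)) *ᵥ x₀ ω) ∂P +
        noiseCost N S.A G l M j s := by
    unfold slotCost
    simp only [ofReal_quadratic hQ]
    refine (htraj (l * s + j) (F := fun c => normSq (M *ᵥ c.x))
      (measurable_normSq.comp ((measurable_mulVec _).comp Config.measurable_x))).trans ?_
    simp only [iterate_normSq_newPacket hN hg0 hg1 hK M (fun _ => rfl) hj s]
    rw [lintegral_add_right _ measurable_const,
      lintegral_const_mul' _ _ (ENNReal.pow_ne_top ENNReal.ofReal_ne_top)]
    simp
    rfl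
  let D : ℕ → ℝ≥0∞ := fun j => ∑ i ∈ Finset.range j, noiseGain N (M * S.A ^ i) +
    ∑' q, G ^ q * ∑ i ∈ Finset.range l, noiseGain N (M * S.A ^ (l * q + j) * S.A ^ i)
  have hD (j : ℕ) : D j ≠ ∞ := by
    refine ENNReal.add_ne_top.2 ⟨ENNReal.sum_ne_top.2 fun i _ => hN.noiseGain_ne_top _, ?_⟩
    refine ne_top_of_le_ne_top (b := ∑' q, θ ^ q * ∑ i ∈ Finset.range l,
      (ENNReal.ofReal (C * r ^ (2 * (j + i))) *
        noiseGain N (1 : Matrix (Fin n) (Fin n) ℝ))) ?_ ?_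
    · rw [ENNReal.tsum_mul_right, ENNReal.tsum_geometric]
      refine ENNReal.mul_ne_top ?_ (ENNReal.sum_ne_top.2 fun i _ =>
        ENNReal.mul_ne_top ENNReal.ofReal_ne_top (hN.noiseGain_ne_top _))
      exact ENNReal.inv_ne_top.2 (tsub_pos_of_lt hθ1).ne'
    · refine ENNReal.tsum_le_tsum fun q => ?_
      rw [Finset.mul_sum, Finset.mul_sum]
      refine Finset.sum_le_sum fun i _ => ?_
      rw [Matrix.mul_assoc, ← pow_add, add_assoc]
      exact hnoise q (j + i)
  have hDs (j s : ℕ) : noiseCost N S.A G l M j s ≤ D j :=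
    add_le_add le_rfl (ENNReal.sum_le_tsum _)
  refine exists_tendsto_average (l := l) l.pos (fun t => ?_) (D := D) (fun j _ => hD j)
    fun j hj => ?_
  · rw [← Nat.div_add_mod t l, hcost _ _ (Nat.mod_lt _ l.pos)]
    refine ENNReal.add_ne_top.2 ⟨ne_top_of_le_ne_top ?_ (hinit _ _),
      ne_top_of_le_ne_top (hD _) (hDs _ _)⟩
    exact ENNReal.mul_ne_top (ENNReal.pow_ne_top ENNReal.ofReal_ne_top) (hX _)
  · simp only [hcost _ j hj]
    rw [← zero_add (D j)]
    refine Tendsto.add ?_ (tendsto_const_nhds.add (ENNReal.tendsto_nat_tsum _))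
    refine tendsto_of_tendsto_of_tendsto_of_le_of_le tendsto_const_nhds ?_ (fun _ => zero_le)
      (fun s => hinit s j)
    have h := ENNReal.Tendsto.mul_const (b := ENNReal.ofReal (C * r ^ (2 * j)) *
      ∫⁻ ω, normSq (x₀ ω) ∂P) (ENNReal.tendsto_pow_atTop_nhds_zero_of_lt_one hθ1) (Or.inr (hX j))
    rwa [zero_mul] at h

end

end

end WNCS

theorem theorem2 {n m : ℕ} {Ω : Type*} [MeasurableSpace Ω] (P : Measure Ω) [IsProbabilityMeasure P]
    -- the plant and the controller gain
    (S : WNCS.Loop n m) (hK : S.A + S.B * S.K = 0)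
    -- the noise covariance, the cost weight and the packet error probability
    (R Q : Matrix (Fin n) (Fin n) ℝ) (hR : R.PosSemidef) (hQ : Q.PosSemidef)
    (hctrl : WNCS.Controllable S.A (CFC.sqrt R)) (hobs : WNCS.Observable S.A (CFC.sqrt Q))
    (g : ℕ+ → ℝ) (hg : Antitone g)
    -- the initial plant state and the initial age of information
    (x₀ : Ω → Fin n → ℝ) (hx₀ : Measurable x₀) (hx₀2 : MemLp x₀ 2 P) (d₀ : ℕ+)
    -- the disturbance: Gaussian white noise with covariance `R`
    (w : ℕ → Ω → Fin n → ℝ) (hw : ∀ t, Measurable (w t))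
    (hwlaw : ∀ t, HasLaw (fun ω => WithLp.toLp 2 (w t ω)) (multivariateGaussian 0 R) P)
    (hwind : iIndepFun w P)
    -- the packet errors: `e t ω l = true` if a packet of length `l` arriving in slot `t` is
    -- erroneous, which has probability `g l`, independently in different slots
    (e : ℕ → Ω → ℕ+ → Bool) (he : ∀ t, Measurable (e t))
    (heprob : ∀ t l, P.real {ω | e t ω l = true} = g l)
    (heind : iIndepFun e P)
    -- initial state, disturbance sequence and error sequence are mutually independent
    (hind₁ : IndepFun (fun ω t => w t ω) (fun ω t => e t ω) P)
    (hind₂ : IndepFun x₀ (fun ω => ((fun t => w t ω), (fun t => e t ω))) P) :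
    -- some policy makes the average cost (as a limit) exist and be finite iff the condition holds
    ((∃ (π : WNCS.Policy) (J : ℝ≥0),
        Tendsto (WNCS.avgCost P S Q x₀ d₀ w e π) atTop (𝓝 (J : ℝ≥0∞))) ↔
      (⨅ l : ℕ+, g l * WNCS.rho S.A ^ (2 * (l : ℕ))) < 1) ∧
    -- some policy keeps the averages bounded iff the condition holds
    ((∃ (π : WNCS.Policy), limsup (WNCS.avgCost P S Q x₀ d₀ w e π) atTop < ∞) ↔
      (⨅ l : ℕ+, g l * WNCS.rho S.A ^ (2 * (l : ℕ))) < 1) := by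
  have hg0 (l : ℕ+) : 0 ≤ g l := heprob 0 l ▸ measureReal_nonneg
  have hg1 (l : ℕ+) : g l ≤ 1 := heprob 0 l ▸ measureReal_le_one
  have hN := WNCS.isNoise_gaussian R
  have hmap (t : ℕ) := WNCS.map_eq_of_hasLaw (hw t) (hwlaw t)
  have htraj (π : WNCS.Policy) (t : ℕ) {F : WNCS.Config n m → ℝ≥0∞} (hF : Measurable F) :=
    WNCS.lintegral_trajectory S π d₀ hx₀ hw hwind he heind hind₁ hind₂ hmap heprob t hF
  have htm (π : WNCS.Policy) (t : ℕ) : Measurable fun ω =>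
      WNCS.trajectory S π (x₀ ω) d₀ (fun s => w s ω) (fun s => e s ω) t :=
    (WNCS.measurable_trajectory S π d₀ t).comp
      (f := fun ω => (x₀ ω, (fun s => w s ω), (fun s => e s ω))) (by fun_prop)
  have hbdd : BddBelow (Set.range fun l : ℕ+ => g l * WNCS.rho S.A ^ (2 * (l : ℕ))) :=
    ⟨0, by
      rintro _ ⟨l, rfl⟩
      exact mul_nonneg (hg0 l) (pow_nonneg (WNCS.rho_nonneg _) _)⟩
  have hnec (π : WNCS.Policy) (h : limsup (WNCS.avgCost P S Q x₀ d₀ w e π) atTop < ∞) :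
      (⨅ l : ℕ+, g l * WNCS.rho S.A ^ (2 * (l : ℕ))) < 1 := by
    by_contra hinf
    refine h.ne (WNCS.limsup_avgCost_eq_top S π d₀ hR hQ hctrl hobs hg hg0 hg1 hN
      (WNCS.integral_sq_gaussian hR) (htraj π) (htm π) fun l => ?_)
    exact (not_lt.1 hinf).trans (ciInf_le hbdd l)
  have hsuf (h : (⨅ l : ℕ+, g l * WNCS.rho S.A ^ (2 * (l : ℕ))) < 1) :
      ∃ (π : WNCS.Policy) (J : ℝ≥0),
        Tendsto (WNCS.avgCost P S Q x₀ d₀ w e π) atTop (𝓝 (J : ℝ≥0∞)) := by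
    obtain ⟨l, hl⟩ := exists_lt_of_ciInf_lt h
    exact ⟨fun _ => l, WNCS.exists_tendsto_avgCost S hK d₀ hQ hg0 hg1 hN hx₀2 (htraj _) hl⟩
  refine ⟨⟨fun ⟨π, J, hJ⟩ => hnec π ?_, hsuf⟩, fun ⟨π, h⟩ => hnec π h, fun h => ?_⟩
  · rw [hJ.limsup_eq]
    exact ENNReal.coe_lt_top
  · obtain ⟨π, J, hJ⟩ := hsuf h
    refine ⟨π, ?_⟩
    rw [hJ.limsup_eq]
    exact ENNReal.coe_lt_top
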